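/- **Theorem (Unisolvence).** Let $V$ be a finite set with $n+1$ elements, $n\ge 0$, let $0\le k\le n$, and let $T=\{\lambda\in\mathbb R_{\ge0}^V:\sum_{i}\lambda_i=1\}$. Choose an ordering (representing an orientation) of every nonempty subset $W\subseteq V$, i.e. an orientation of every face $T_W$ of $T$, including $T$ itself. Let $\omega=n!\,i_X(\bigwedge_{i\in V}d\lambda_i)|_T$, with $X=\sum_i\lambda_i\partial_{\lambda_i}$, be the volume form on $T$ with $\int_T\omega=1$. A *flag* is an ordered partition $F=(V_0,\dots,V_{n-k})$ of $V$ into $n-k+1$ nonempty sets. Let $R_F$ be the simplex with barycentric coordinates $\rho_0,\dots,\rho_{n-k}$, let $\Theta_F=\prod_j T_{V_j}=\{\theta\in\mathbb R^V_{\ge0}:\sum_{i\in V_j}\theta_i=1\ \forall j\}$ with the product orientation, and let $\Phi_F:\mathring R_F\times\mathring\Theta_F\to\mathring T$, $\lambda_i=\rho_j\theta_i$ for $i\in V_j$ (quasi-cylindrical coordinates). Orient $R_F$ so that $\Phi_F$ preserves orientation. *Blow-up Whitney forms.* For $\rho\in\mathring R_F$ let $R_\rho=\{r\in R_F: r_j/\rho_j\le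 r_{j'}/\rho_{j'}\text{ whenever } j\le j'\}$, and let $\psi_{F,\rho}=\int_{R_\rho}\Phi_F^*\omega$, a $k$-form on $\mathring\Theta_F$ obtained by integration over the $R_F$ factor. The $k$-form $\psi_F$ on $\mathring T$ is given at the point $x=\Phi_F(\rho,\theta)$ by $\psi_F(X_1,\dots,X_k)=\psi_{F,\rho}|_\theta(Y_1,\dots,Y_k)$, where $Y_a$ is the projection of $X_a$ to the $\Theta_F$ factor. Let $b\mathcal P_1^-\Lambda^k(T)$ be the span of the forms $\psi_F$ over all flags $F$ with $n-k+1$ sets. *Degrees of freedom.* For a $k$-form $\psi$ on $\mathring T$ and $\rho\in\mathring R_F$ let $\psi_\rho$ be the pullback of $\psi$ to $\{\rho\}\times\mathring\Theta_F$, and let $$\Psi_F(\psi)=\int_{\Theta_F}\lim_{\rho_1\to0}\cdots\lim_{\rho_{n-k}\to0}\psi_\rho ,$$ where the limits are taken pointwise on $\mathring\Theta_F$, and the limit $\rho_j\to0$ approaches each point of the interior of the face $\{\rho_j=\dots=\rho_{n-k}=0\}$ of $R_F$ through the interior of the face $\{\rho_{j+1}=\dots=\rho_{n-k}=0\}$.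 $\Psi_F(\psi)$ is defined if all these limits exist and the limit form is integrable. Then every $\Psi_F$ is well defined and linear on $b\mathcal P_1^-\Lambda^k(T)$, and $$\Psi_{F'}(\psi_F)=\begin{cases}1,&F'=F,\\0,&F'\ne F,\end{cases}$$ for all flags $F,F'$ with $n-k+1$ sets. The forms $\psi_F$ form a basis of $b\mathcal P_1^-\Lambda^k(T)$, and the functionals $\Psi_F$ form the dual basis of its dual space. -/

import Mathlib

open MeasureTheory Filter Topology

noncomputable section

namespace BlowUpWhitney

/-! ### The simplex, its tangent space, differential forms, orientations -/

/-- The interior of the standard barycentric simplex with vertex set `ι`. -/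
def openSimplex (ι : Type*) [Fintype ι] : Set (ι → ℝ) :=
  {x | (∀ i, 0 < x i) ∧ ∑ i, x i = 1}

/-- The tangent space of the barycentric simplex with vertex set `V`
(the same at every point): vectors whose components sum to zero. -/
def tangentT (V : Type*) [Fintype V] : Submodule ℝ (V → ℝ) where
  carrier := {v | ∑ i, v i = 0}
  add_mem' := by
    intro a b ha hb
    simp only [Set.mem_ofPred_eq] at ha hb
    simp [Finset.sum_add_distrib, ha, hb]
  zero_mem' := by simp
  smul_mem' := by
    intro c a ha
    simp only [Set.mem_ofPred_eq] at ha
    simp [← Finset.mul_sum, ha]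

/-- Differential `k`-forms on the interior of the simplex `T` with vertex set `V`. -/
abbrev KForm (V : Type*) [Fintype V] (k : ℕ) : Type _ :=
  ↥(openSimplex V) → (tangentT V) [⋀^Fin k]→ₗ[ℝ] ℝ

/-- A choice of ordering of the vertices of each face. Each ordering represents an orientation of
that face (orientations are orderings modulo even permutations). The face `univ` is `T` itself. -/
abbrev FaceOrdering (V : Type*) : Type _ := ∀ W : Finset V, Fin W.card ≃ W

/-- The chosen ordering of all vertices of `T`, for a simplex of dimension `N + k`. -/
def topOrder {V : Type*} [Fintype V] {N k : ℕ} (hV : Fintype.card V = N + k + 1)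
    (o : FaceOrdering V) : Fin (N + k + 1) ≃ V :=
  ((finCongr (hV.symm.trans Finset.card_univ.symm)).trans (o Finset.univ)).trans
    (Equiv.subtypeUnivEquiv (fun i => Finset.mem_univ i))

/-- `dλ_V`, the wedge product of the coordinate one-forms `dλ_i` in the chosen order. -/
def dLambda {V : Type*} [Fintype V] {N k : ℕ} (hV : Fintype.card V = N + k + 1)
    (o : FaceOrdering V) : (V → ℝ) [⋀^Fin (N + k + 1)]→ₗ[ℝ] ℝ :=
  (Matrix.detRowAlternating (n := Fin (N + k + 1)) (R := ℝ)).compLinearMap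
    (LinearMap.funLeft ℝ ℝ (topOrder hV o))

/-- The form `n! • i_X dλ_V`, with `n = N + k` and `X = ∑ λ_i ∂/∂λ_i`, at the point `x`.
Restricted to `T` it is the multiple of the (oriented) volume form with integral one. -/
def whitneyForm {V : Type*} [Fintype V] {N k : ℕ} (hV : Fintype.card V = N + k + 1)
    (o : FaceOrdering V) (x : V → ℝ) : (V → ℝ) [⋀^Fin (N + k)]→ₗ[ℝ] ℝ :=
  ((N + k).factorial : ℝ) • (dLambda hV o).curryLeft x

/-! ### Flags and quasi-cylindrical coordinates -/

/-- A flag: an ordered partition of `V` into `N + 1` nonempty sets `V_0, …, V_N`, given by the map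
sending each vertex to the index of the set containing it. -/
@[ext]
structure VertexFlag (V : Type*) (N : ℕ) where
  idx : V → Fin (N + 1)
  surj : Function.Surjective idx

instance (V : Type*) (N : ℕ) : DecidableEq (VertexFlag V N) := Classical.decEq _

namespace VertexFlag

variable {V : Type*} [Fintype V] {N : ℕ}

/-- The set `V_j` of the partition. -/
def block (F : VertexFlag V N) (j : Fin (N + 1)) : Finset V :=
  Finset.univ.filter (fun i => F.idx i = j)

theorem card_block_pos (F : VertexFlag V N) (j : Fin (N + 1)) : 0 < (F.block j).card := by
  obtain ⟨i, hi⟩ := F.surj j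
  exact Finset.card_pos.2 ⟨i, by simp [block, hi]⟩

theorem sum_block {M : Type*} [AddCommMonoid M] (F : VertexFlag V N) (f : V → M) :
    ∑ j, ∑ i ∈ F.block j, f i = ∑ i, f i := by
  simpa [block] using Finset.sum_fiberwise Finset.univ F.idx f

theorem sum_card_block (F : VertexFlag V N) : ∑ j, (F.block j).card = Fintype.card V := by
  simpa using F.sum_block (fun _ => (1 : ℕ))

/-- The interior of the angular space `Θ = ∏ j, T_{V_j}`. -/
def openTheta (F : VertexFlag V N) : Set (V → ℝ) :=
  {θ | (∀ i, 0 < θ i) ∧ ∀ j, ∑ i ∈ F.block j, θ i = 1}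

/-- The tangent space of `Θ`. -/
def tangentTheta (F : VertexFlag V N) : Submodule ℝ (V → ℝ) where
  carrier := {v | ∀ j, ∑ i ∈ F.block j, v i = 0}
  add_mem' := by
    intro a b ha hb j
    simp [Finset.sum_add_distrib, ha j, hb j]
  zero_mem' := by intro j; simp
  smul_mem' := by
    intro c a ha j
    simp [← Finset.mul_sum, ha j]

/-- The quasi-cylindrical coordinate map `Φ : R × Θ → T`, `λ_i = ρ_j θ_i` for `i ∈ V_j`. -/
def Phi (F : VertexFlag V N) (ρ : Fin (N + 1) → ℝ) (θ : V → ℝ) : V → ℝ :=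
  fun i => ρ (F.idx i) * θ i

theorem sum_block_mul (F : VertexFlag V N) (ρ : Fin (N + 1) → ℝ) (θ : V → ℝ) (j : Fin (N + 1)) :
    ∑ i ∈ F.block j, ρ (F.idx i) * θ i = ρ j * ∑ i ∈ F.block j, θ i := by
  rw [Finset.mul_sum]
  refine Finset.sum_congr rfl fun i hi => ?_
  rw [(Finset.mem_filter.1 hi).2]

theorem Phi_mem (F : VertexFlag V N) {ρ : Fin (N + 1) → ℝ} {θ : V → ℝ}
    (hρ : ρ ∈ openSimplex (Fin (N + 1))) (hθ : θ ∈ F.openTheta) :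
    F.Phi ρ θ ∈ openSimplex V := by
  refine ⟨fun i => mul_pos (hρ.1 _) (hθ.1 i), ?_⟩
  rw [← F.sum_block]
  simp only [Phi, sum_block_mul, hθ.2, mul_one]
  exact hρ.2

/-- The derivative of `Φ` at `(ρ, θ)` in the direction `u` tangent to `R`. -/
def dPhiRadial (F : VertexFlag V N) (θ : V → ℝ) (u : Fin (N + 1) → ℝ) : V → ℝ :=
  fun i => u (F.idx i) * θ i

/-- The derivative of `Φ` at `(ρ, θ)` in directions tangent to `Θ`. It lifts a vector tangent
to `Θ` to the vector on `T`, tangent to the `Θ` factor, that projects to it. -/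
def dPhiAngular (F : VertexFlag V N) (ρ : Fin (N + 1) → ℝ) : F.tangentTheta →ₗ[ℝ] tangentT V where
  toFun Y := ⟨fun i => ρ (F.idx i) * (Y : V → ℝ) i, by
    change ∑ i, ρ (F.idx i) * (Y : V → ℝ) i = 0
    rw [← F.sum_block]
    simp only [sum_block_mul]
    exact Finset.sum_eq_zero fun j _ => by rw [Y.2 j, mul_zero]⟩
  map_add' := by intro a b; ext i; simp [mul_add]
  map_smul' := by intro c a; ext i; simp [mul_left_comm]

/-- The radial coordinates `ρ_j = ∑_{i ∈ V_j} λ_i` of a point. -/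
def rho (F : VertexFlag V N) (x : V → ℝ) : Fin (N + 1) → ℝ := fun j => ∑ i ∈ F.block j, x i

/-- The angular coordinates `θ_i = λ_i / ρ_j`, `i ∈ V_j`, of a point. -/
def theta (F : VertexFlag V N) (x : V → ℝ) : V → ℝ := fun i => x i / F.rho x (F.idx i)

/-- The derivative of `theta` at `x`, that is, the projection of vectors at `x` to `Θ`. -/
def dTheta (F : VertexFlag V N) (x : V → ℝ) : tangentT V →ₗ[ℝ] F.tangentTheta where
  toFun X := ⟨fun i => (X : V → ℝ) i / F.rho x (F.idx i)
      - x i * F.rho X (F.idx i) / F.rho x (F.idx i) ^ 2, by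
    intro j
    have h : ∀ i ∈ F.block j, (X : V → ℝ) i / F.rho x (F.idx i)
        - x i * F.rho X (F.idx i) / F.rho x (F.idx i) ^ 2
        = (X : V → ℝ) i * (1 / F.rho x j) - x i * (F.rho X j / F.rho x j ^ 2) := by
      intro i hi
      rw [(Finset.mem_filter.1 hi).2]
      ring
    rw [Finset.sum_congr rfl h, Finset.sum_sub_distrib, ← Finset.sum_mul, ← Finset.sum_mul]
    change F.rho X j * (1 / F.rho x j) - F.rho x j * (F.rho X j / F.rho x j ^ 2) = 0
    by_cases h0 : F.rho x j = 0
    · simp [h0]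
    · field_simp
      ring⟩
  map_add' := by
    intro a b
    ext i
    simp only [rho, Submodule.coe_add, Pi.add_apply, Finset.sum_add_distrib]
    ring
  map_smul' := by
    intro c a
    ext i
    simp only [rho, Submodule.coe_smul, Pi.smul_apply, smul_eq_mul, ← Finset.mul_sum,
      RingHom.id_apply]
    ring

/-! ### Charts and oriented frames of `Θ` and `R` -/

/-- The vertex number `l` of `V_j` in the chosen ordering. -/
def vertex (F : VertexFlag V N) (o : FaceOrdering V) (j : Fin (N + 1)) (l : Fin (F.block j).card) : V :=
  (o (F.block j) l : V)

/-- Index set of the standard chart of `Θ`: pairs `(j, l)`, where `j` is the number of a factor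
`T_{V_j}` and `l + 1` is the number of a vertex of `V_j` different from the first one. -/
abbrev ThetaIdx (F : VertexFlag V N) : Type := (j : Fin (N + 1)) × Fin ((F.block j).card - 1)

/-- The first vertex of `V_j`. -/
def baseVertex (F : VertexFlag V N) (o : FaceOrdering V) (j : Fin (N + 1)) : V :=
  F.vertex o j ⟨0, F.card_block_pos j⟩

/-- The other vertices of `V_j`. -/
def otherVertex (F : VertexFlag V N) (o : FaceOrdering V) (a : F.ThetaIdx) : V :=
  F.vertex o a.1 ⟨a.2 + 1, by have := a.2.2; omega⟩

theorem vertex_mem (F : VertexFlag V N) (o : FaceOrdering V) (j : Fin (N + 1))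
    (l : Fin (F.block j).card) : F.vertex o j l ∈ F.block j :=
  (o (F.block j) l).2

open Classical in
/-- The frame vector of `Θ` pointing from the first vertex of `V_j` to another one. -/
def frameVector (F : VertexFlag V N) (o : FaceOrdering V) (a : F.ThetaIdx) : F.tangentTheta :=
  ⟨Pi.single (F.otherVertex o a) 1 - Pi.single (F.baseVertex o a.1) 1, by
    intro j
    have h1 := F.vertex_mem o a.1 ⟨a.2 + 1, by have := a.2.2; omega⟩
    have h2 := F.vertex_mem o a.1 ⟨0, F.card_block_pos a.1⟩
    simp only [block, Finset.mem_filter, Finset.mem_univ, true_and] at h1 h2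
    simp only [Pi.sub_apply, Finset.sum_sub_distrib, Finset.sum_pi_single', block,
      Finset.mem_filter, Finset.mem_univ, true_and, otherVertex, baseVertex, h1, h2, sub_self]⟩

open Classical in
/-- The standard affine chart of `Θ`: the point with the given barycentric coordinates at all
vertices other than the first ones of the sets `V_j`. -/
def thetaChart (F : VertexFlag V N) (o : FaceOrdering V) (s : F.ThetaIdx → ℝ) : V → ℝ :=
  (∑ j, Pi.single (F.baseVertex o j) 1) + ∑ a, s a • (F.frameVector o a : V → ℝ)

theorem sum_card_sub_one {k : ℕ} (hV : Fintype.card V = N + k + 1) (F : VertexFlag V N) :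
    k = ∑ j, ((F.block j).card - 1) := by
  have h1 : ∑ j, (((F.block j).card - 1) + 1) = Fintype.card V := by
    rw [← F.sum_card_block]
    exact Finset.sum_congr rfl fun j _ => Nat.sub_add_cancel (F.card_block_pos j)
  rw [Finset.sum_add_distrib] at h1
  simp at h1
  omega

/-- The positively oriented frame of `Θ = T_{V_0} × ⋯ × T_{V_N}`: the oriented frames of the
factors, one after the other. -/
def thetaFrame {k : ℕ} (hV : Fintype.card V = N + k + 1) (o : FaceOrdering V) (F : VertexFlag V N) :
    Fin k → F.tangentTheta :=
  fun a => F.frameVector o (finSigmaFinEquiv.symm (finCongr (F.sum_card_sub_one hV) a))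

end VertexFlag

/-- The standard affine chart of the simplex with vertices `0, …, N`. -/
def radialChart {N : ℕ} (t : Fin N → ℝ) : Fin (N + 1) → ℝ := Fin.cons (1 - ∑ a, t a) t

/-- The frame of the simplex with vertices `0, …, N` associated with `radialChart`. -/
def radialFrame {N : ℕ} (a : Fin N) : Fin (N + 1) → ℝ := Pi.single a.succ 1 - Pi.single 0 1

/-! ### Blow-up Whitney forms -/

/-- The subset `R_ρ` of the radial simplex `R`. -/
def radialRegion {N : ℕ} (ρ : Fin (N + 1) → ℝ) : Set (Fin (N + 1) → ℝ) :=
  {r | r ∈ stdSimplex ℝ (Fin (N + 1)) ∧ ∀ j j', j ≤ j' → r j / ρ j ≤ r j' / ρ j'}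

section

variable {V : Type*} [Fintype V] {N k : ℕ}

/-- The orientation of `R`: the sign of `radialFrame` in the orientation for which
`Φ : R × Θ → T` preserves orientation (the sign is the same at all interior points, and
is read off at the barycenter). -/
def radialSign (hV : Fintype.card V = N + k + 1) (o : FaceOrdering V) (F : VertexFlag V N) : ℝ :=
  let ρ : Fin (N + 1) → ℝ := fun _ => 1 / (N + 1)
  let θ : V → ℝ := fun i => 1 / ((F.block (F.idx i)).card : ℝ)
  Real.sign (whitneyForm hV o (F.Phi ρ θ) (Fin.append
    (fun a => F.dPhiRadial θ (radialFrame a))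
    (fun b => (F.dPhiAngular ρ (F.thetaFrame hV o b) : V → ℝ))))

theorem append_update {M : Type*} [DecidableEq (Fin k)] (E : Fin N → M) (Y : Fin k → M)
    (i : Fin k) (z : M) : Fin.append E (Function.update Y i z)
      = Function.update (Fin.append E Y) (Fin.natAdd N i) z := by
  ext a
  refine Fin.addCases (fun b => ?_) (fun b => ?_) a
  · rw [Function.update_of_ne]
    · simp
    · intro hb
      have := congrArg Fin.val hb
      simp at this
      omega
  · by_cases hb : b = i
    · subst hb; simp
    · rw [Function.update_of_ne]
      · simp [hb]
      · simpa using hb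

/-- Inserting the vectors `E` into the first slots of a form. -/
def contractFirst {M : Type*} [AddCommGroup M] [Module ℝ M]
    (ω : M [⋀^Fin (N + k)]→ₗ[ℝ] ℝ) (E : Fin N → M) : M [⋀^Fin k]→ₗ[ℝ] ℝ where
  toFun Y := ω (Fin.append E Y)
  map_update_add' := by
    intro _ Y i x y
    simp only [append_update, AlternatingMap.map_update_add]
  map_update_smul' := by
    intro _ Y i c x
    simp only [append_update, AlternatingMap.map_update_smul]
  map_eq_zero_of_eq' := by
    intro Y i j hij hne
    refine ω.map_eq_zero_of_eq (i := Fin.natAdd N i) (j := Fin.natAdd N j) _ ?_ ?_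
    · simpa using hij
    · simpa using hne

/-- The integral of a family of alternating forms. -/
def integralForm {α M : Type*} [MeasurableSpace α] [AddCommGroup M] [Module ℝ M]
    (μ : Measure α) (η : α → M [⋀^Fin k]→ₗ[ℝ] ℝ)
    (hη : ∀ Y, Integrable (fun t => η t Y) μ) : M [⋀^Fin k]→ₗ[ℝ] ℝ where
  toFun Y := ∫ t, η t Y ∂μ
  map_update_add' := by
    intro _ Y i x y
    simp only [AlternatingMap.map_update_add]
    exact integral_add (hη _) (hη _)
  map_update_smul' := by
    intro _ Y i c x
    simp only [AlternatingMap.map_update_smul]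
    exact integral_smul c _
  map_eq_zero_of_eq' := by
    intro Y i j hij hne
    simp [AlternatingMap.map_eq_zero_of_eq _ Y hij hne]

/-- The `k`-form on `Θ` at `θ` that is obtained from the pullback `Φ^* ω` at the point of `R × Θ`
with radial chart coordinates `t` by inserting the frame of `R` into the first `N` slots. -/
def fiberIntegrand (hV : Fintype.card V = N + k + 1) (o : FaceOrdering V) (F : VertexFlag V N)
    (θ : V → ℝ) (t : Fin N → ℝ) : F.tangentTheta [⋀^Fin k]→ₗ[ℝ] ℝ :=
  (contractFirst (whitneyForm hV o (F.Phi (radialChart t) θ))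
    (fun a => F.dPhiRadial θ (radialFrame a))).compLinearMap
    ((tangentT V).subtype ∘ₗ F.dPhiAngular (radialChart t))

theorem integrable_fiberIntegrand (hV : Fintype.card V = N + k + 1) (o : FaceOrdering V)
    (F : VertexFlag V N) (ρ : Fin (N + 1) → ℝ) (θ : V → ℝ) (Y : Fin k → F.tangentTheta) :
    Integrable (fun t => fiberIntegrand hV o F θ t Y)
      (volume.restrict {t : Fin N → ℝ | radialChart t ∈ radialRegion ρ}) := by
  have hchart : Continuous (fun t : Fin N → ℝ => radialChart t) := by
    refine continuous_pi fun j => ?_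
    refine Fin.cases ?_ (fun a => ?_) j
    · simp only [radialChart, Fin.cons_zero]; fun_prop
    · simp only [radialChart, Fin.cons_succ]; fun_prop
  have hcont : Continuous (fun t => fiberIntegrand hV o F θ t Y) := by
    have : (fun t => fiberIntegrand hV o F θ t Y) = fun t : Fin N → ℝ =>
        ((N + k).factorial : ℝ) * Matrix.det (Matrix.of
          (fun a b => (Fin.cons (F.Phi (radialChart t) θ) (Fin.append
            (fun a => F.dPhiRadial θ (radialFrame a))
            (fun b => (F.dPhiAngular (radialChart t) (Y b) : V → ℝ))) :
              Fin (N + k + 1) → V → ℝ) a (topOrder hV o b))) := rfl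
    rw [this]
    refine continuous_const.mul (Continuous.matrix_det ?_)
    refine continuous_pi fun a => continuous_pi fun b => ?_
    simp only [Matrix.of_apply]
    refine Fin.cases ?_ (fun a => ?_) a
    · simp only [Fin.cons_zero, VertexFlag.Phi]
      exact ((continuous_apply _).comp hchart).mul continuous_const
    · simp only [Fin.cons_succ]
      refine Fin.addCases (fun c => ?_) (fun c => ?_) a
      · simp only [Fin.append_left]; exact continuous_const
      · simp only [Fin.append_right]
        exact ((continuous_apply _).comp hchart).mul continuous_const
  have hsub : {t : Fin N → ℝ | radialChart t ∈ radialRegion ρ} ⊆ Set.Icc 0 1 := by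
    intro t ht
    have h0 : ∀ a, 0 ≤ t a := fun a => by
      simpa [radialChart] using ht.1.1 a.succ
    have h1 : 0 ≤ 1 - ∑ a, t a := by simpa [radialChart] using ht.1.1 0
    refine ⟨h0, fun a => ?_⟩
    have := Finset.single_le_sum (f := t) (fun b _ => h0 b) (Finset.mem_univ a)
    simp only [Pi.one_apply]
    linarith
  exact (hcont.integrableOn_Icc).mono_set hsub

/-- The `k`-form `ψ_{F,ρ} = ∫_{R_ρ} ω` on `Θ`, at the point `θ`. -/
def psiRadial (hV : Fintype.card V = N + k + 1) (o : FaceOrdering V) (F : VertexFlag V N)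
    (ρ : Fin (N + 1) → ℝ) (θ : V → ℝ) : F.tangentTheta [⋀^Fin k]→ₗ[ℝ] ℝ :=
  radialSign hV o F •
    integralForm (volume.restrict {t : Fin N → ℝ | radialChart t ∈ radialRegion ρ})
      (fiberIntegrand hV o F θ) (integrable_fiberIntegrand hV o F ρ θ)

/-- The blow-up Whitney form `ψ_F` on the interior of `T`. -/
def psi (hV : Fintype.card V = N + k + 1) (o : FaceOrdering V) (F : VertexFlag V N) : KForm V k :=
  fun x => (psiRadial hV o F (F.rho x) (F.theta x)).compLinearMap (F.dTheta x)

/-- The space of blow-up Whitney `k`-forms on `T`. -/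
def blowUpWhitneySpace (hV : Fintype.card V = N + k + 1) (o : FaceOrdering V) :
    Submodule ℝ (KForm V k) :=
  Submodule.span ℝ (Set.range fun F : VertexFlag V N => psi hV o F)

/-! ### Degrees of freedom -/

/-- The interior of the face of the simplex `R` with vertices `0, …, m`. -/
def openFace (N m : ℕ) : Set (Fin (N + 1) → ℝ) :=
  {ρ | (∀ j : Fin (N + 1), (j : ℕ) ≤ m → 0 < ρ j) ∧
    (∀ j : Fin (N + 1), m < (j : ℕ) → ρ j = 0) ∧ ∑ j, ρ j = 1}

/-- `lim_{ρ_1 → 0} ⋯ lim_{ρ_N → 0} g(ρ) = c` for a function `g` on the interior of `R`.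
The function `G m` on the interior of the face with vertices `0, …, m` is the result of taking the
limits `ρ_N → 0`, …, `ρ_{m+1} → 0`; the limit `ρ_{m+1} → 0` approaches points in the interior of
the face with vertices `0, …, m` from the interior of the face with vertices `0, …, m + 1`. -/
def HasIteratedLimit (g : ↥(openSimplex (Fin (N + 1))) → ℝ) (c : ℝ) : Prop :=
  ∃ G : ∀ m : ℕ, ↥(openFace N m) → ℝ,
    (∀ ρ (h : ρ ∈ openFace N N) (h' : ρ ∈ openSimplex (Fin (N + 1))), G N ⟨ρ, h⟩ = g ⟨ρ, h'⟩) ∧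
    (∀ m, m < N → ∀ ρ : ↥(openFace N m),
      Tendsto (G (m + 1)) (comap Subtype.val (𝓝 (ρ : Fin (N + 1) → ℝ))) (𝓝 (G m ρ))) ∧
    ∀ ρ : ↥(openFace N 0), G 0 ρ = c

/-- The pullback `ψ_ρ` of a `k`-form on `T` to `{ρ} × Θ`, at the point `θ`. -/
def pullbackTheta (F : VertexFlag V N) (ψ : KForm V k) (ρ : ↥(openSimplex (Fin (N + 1))))
    (θ : ↥F.openTheta) : F.tangentTheta [⋀^Fin k]→ₗ[ℝ] ℝ :=
  (ψ ⟨F.Phi ρ θ, F.Phi_mem ρ.2 θ.2⟩).compLinearMap (F.dPhiAngular ρ)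

open Classical in
/-- The coefficient of a top-degree form on the interior of `Θ` in the oriented standard chart
(extended by zero outside the domain of the chart). -/
def thetaCoeff (hV : Fintype.card V = N + k + 1) (o : FaceOrdering V) (F : VertexFlag V N)
    (η : ↥F.openTheta → F.tangentTheta [⋀^Fin k]→ₗ[ℝ] ℝ) (s : F.ThetaIdx → ℝ) : ℝ :=
  if h : F.thetaChart o s ∈ F.openTheta then
    η ⟨F.thetaChart o s, h⟩ (F.thetaFrame hV o) else 0

/-- The degree of freedom `Ψ_F` is defined at the `k`-form `ψ` and has the value `c`: the iterated
limits of `ψ_ρ` exist pointwise on the interior of `Θ`, and the resulting `k`-form `η` is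
integrable over `Θ` with integral `c`. -/
def HasDof (hV : Fintype.card V = N + k + 1) (o : FaceOrdering V) (F : VertexFlag V N)
    (ψ : KForm V k) (c : ℝ) : Prop :=
  ∃ η : ↥F.openTheta → F.tangentTheta [⋀^Fin k]→ₗ[ℝ] ℝ,
    (∀ θ Y, HasIteratedLimit (fun ρ => pullbackTheta F ψ ρ θ Y) (η θ Y)) ∧
    Integrable (thetaCoeff hV o F η) ∧
    ∫ s, thetaCoeff hV o F η s = c

end

end BlowUpWhitney

end

open BlowUpWhitney

/-!
Write `n = N + k` and `n_j = |V_j|`, let `vol` be the determinant on tangent vectors of `Θ_F` in the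
oriented frame, and let `r` be a point of `R_F`. In quasi-cylindrical coordinates the volume form is
`Φ_F^* ω = ± n! ∏ j, r_j ^ (n_j - 1) dr ∧ vol` (`fiberIntegrand_eq`), and the orientation of `R_F`
cancels the sign (`radialSign_eq`). Hence `ψ_{F,ρ} = K_F(ρ) vol`, where
`K_F(ρ) = n! ∫_{R_ρ} ∏ j, r_j ^ (n_j - 1) dr` depends only on the ratios
`τ_{j j'} = ρ_j / (ρ_j + ρ_{j'})`. The integral is a continuous function of arbitrary real numbers
`τ_{j j'}` (`continuous_ratioIntegral`), because the hyperplane bounding a ratio condition never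
degenerates to the whole space.

Let `(ρ, θ)` be quasi-cylindrical coordinates for a flag `F'`. The pullback of `ψ_F` to
`{ρ} × Θ_{F'}` is a continuous function of the angular coordinates for `F` and of the ratios of
radial coordinates for `F`, and all of these are ratios of linear forms in `ρ` whose
denominators have nonnegative coefficients. Such a ratio has an iterated limit, namely the ratio of
the coefficients at the first nonzero coefficient of the denominator (`hasIterLim_ratio`), so the
iterated limit of the pullback exists and is explicit (`hasIterLim_pullbackTheta_psi`).

If `F' = F`, the angular coordinates are constant and all `τ_{j j'}` with `j < j'` tend to `1`, so
that `R_ρ` fills the simplex and Dirichlet's integral gives the limit `∏ j, (n_j - 1)! vol`. The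
integral of `vol` over `Θ_F` is the product of the volumes `1 / (n_j - 1)!` of the factors, and the
degree of freedom is `1`. If `F' ≠ F`, the limit is zero
(`hasIterLim_pullbackTheta_psi_of_ne`): let `μ_j` be the first index of a set of `F'` that meets
`V_j`. If some `V_j` is not contained in the set with index `μ_j`, the limits of the angular
coordinates at the remaining vertices of `V_j` are identically zero, and `vol` vanishes on the
limits of the tangent vectors. If `μ_j > μ_{j'}` for some `j < j'`, then `τ_{j j'}` tends to `0` and
`R_ρ` shrinks to a null set. Otherwise `μ` is monotone and surjective, hence the identity, and `F' = F`.

Iterated limits are unique, because each open face lies in the closure of the next one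
(`HasIterLim.unique`). The degrees of freedom are therefore well defined and linear, and the
duality relation yields the linear independence of the forms `ψ_F` and the dual basis.
-/

noncomputable section

namespace BlowUpWhitney

/-! ### The oriented frame of `Θ` -/

namespace VertexFlag

variable {V : Type*} [Fintype V] {N : ℕ}

theorem idx_vertex (F : VertexFlag V N) (o : FaceOrdering V) (j : Fin (N + 1))
    (l : Fin (F.block j).card) : F.idx (F.vertex o j l) = j :=
  (Finset.mem_filter.1 (F.vertex_mem o j l)).2

@[simp]
theorem idx_baseVertex (F : VertexFlag V N) (o : FaceOrdering V) (j : Fin (N + 1)) :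
    F.idx (F.baseVertex o j) = j :=
  F.idx_vertex o j _

@[simp]
theorem idx_otherVertex (F : VertexFlag V N) (o : FaceOrdering V) (a : F.ThetaIdx) :
    F.idx (F.otherVertex o a) = a.1 :=
  F.idx_vertex o a.1 _

theorem vertex_injective (F : VertexFlag V N) (o : FaceOrdering V) (j : Fin (N + 1)) :
    Function.Injective (F.vertex o j) :=
  Subtype.val_injective.comp (o (F.block j)).injective

theorem otherVertex_ne_baseVertex (F : VertexFlag V N) (o : FaceOrdering V) (a : F.ThetaIdx)
    (j : Fin (N + 1)) : F.otherVertex o a ≠ F.baseVertex o j := by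
  intro h
  have h1 := congrArg F.idx h
  simp only [idx_otherVertex, idx_baseVertex] at h1
  subst h1
  have := congrArg Fin.val (F.vertex_injective o a.1 h)
  simp at this

theorem otherVertex_injective (F : VertexFlag V N) (o : FaceOrdering V) :
    Function.Injective (F.otherVertex o) := by
  rintro ⟨j, l⟩ ⟨j', l'⟩ h
  have h1 := congrArg F.idx h
  simp only [idx_otherVertex] at h1
  subst h1
  have := congrArg Fin.val (F.vertex_injective o j h)
  simp only [Nat.add_right_cancel_iff] at this
  rw [Fin.ext this]

theorem baseVertex_injective (F : VertexFlag V N) (o : FaceOrdering V) :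
    Function.Injective (F.baseVertex o) := fun j j' h => by
  simpa using congrArg F.idx h

theorem vertexSum_bijective (F : VertexFlag V N) (o : FaceOrdering V) :
    Function.Bijective (Sum.elim (F.baseVertex o) (F.otherVertex o)) := by
  refine ⟨(F.baseVertex_injective o).sumElim (F.otherVertex_injective o)
    fun j a h => F.otherVertex_ne_baseVertex o a j h.symm, fun i => ?_⟩
  have hi : i ∈ F.block (F.idx i) := by simp [block]
  obtain ⟨⟨l, hl⟩, h⟩ := (o (F.block (F.idx i))).surjective ⟨i, hi⟩
  have h' : F.vertex o (F.idx i) ⟨l, hl⟩ = i := congrArg Subtype.val h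
  rcases l with _ | l
  · exact ⟨Sum.inl (F.idx i), h'⟩
  · exact ⟨Sum.inr ⟨F.idx i, ⟨l, by omega⟩⟩, h'⟩

/-- The vertices of `V`, sorted into the first vertices of the sets `V_j` and the others. -/
def vertexEquiv (F : VertexFlag V N) (o : FaceOrdering V) : Fin (N + 1) ⊕ F.ThetaIdx ≃ V :=
  Equiv.ofBijective _ (F.vertexSum_bijective o)

@[simp]
theorem vertexEquiv_inl (F : VertexFlag V N) (o : FaceOrdering V) (j : Fin (N + 1)) :
    F.vertexEquiv o (Sum.inl j) = F.baseVertex o j := rfl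

@[simp]
theorem vertexEquiv_inr (F : VertexFlag V N) (o : FaceOrdering V) (a : F.ThetaIdx) :
    F.vertexEquiv o (Sum.inr a) = F.otherVertex o a := rfl

theorem sum_block_eq (F : VertexFlag V N) (o : FaceOrdering V) {M : Type*} [AddCommMonoid M]
    (f : V → M) (j : Fin (N + 1)) :
    ∑ i ∈ F.block j, f i = f (F.baseVertex o j) + ∑ l, f (F.otherVertex o ⟨j, l⟩) := by
  classical
  simp only [block]
  rw [Finset.sum_filter, ← (F.vertexEquiv o).sum_comp, Fintype.sum_sum_type,
    Fintype.sum_sigma, Finset.sum_eq_single j, Finset.sum_eq_single j]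
  · simp only [vertexEquiv_inl, vertexEquiv_inr, idx_baseVertex, idx_otherVertex, if_true]
    rfl
  · intro j' _ hj; simp [hj]
  · simp
  · intro j' _ hj; simp [hj]
  · simp

open Classical in
theorem frameVector_otherVertex (F : VertexFlag V N) (o : FaceOrdering V) (a b : F.ThetaIdx) :
    (F.frameVector o a : V → ℝ) (F.otherVertex o b) = if a = b then 1 else 0 := by
  simp only [frameVector, Pi.sub_apply, Pi.single_apply, F.otherVertex_ne_baseVertex,
    (F.otherVertex_injective o).eq_iff, if_false, sub_zero, eq_comm]

open Classical in
theorem frameVector_baseVertex (F : VertexFlag V N) (o : FaceOrdering V) (a : F.ThetaIdx)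
    (j : Fin (N + 1)) :
    (F.frameVector o a : V → ℝ) (F.baseVertex o j) = if a.1 = j then -1 else 0 := by
  simp only [frameVector, Pi.sub_apply, Pi.single_apply, (F.otherVertex_ne_baseVertex o a j).symm,
    (F.baseVertex_injective o).eq_iff, if_false, zero_sub, eq_comm (a := j)]
  split_ifs <;> simp

theorem mul_frameVector (F : VertexFlag V N) (o : FaceOrdering V) (ρ : Fin (N + 1) → ℝ)
    (a : F.ThetaIdx) (i : V) :
    ρ (F.idx i) * (F.frameVector o a : V → ℝ) i = ρ a.1 * (F.frameVector o a : V → ℝ) i := by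
  classical
  obtain ⟨j | b, rfl⟩ := (F.vertexEquiv o).surjective i
  · simp only [vertexEquiv_inl, frameVector_baseVertex, idx_baseVertex]
    split_ifs with h <;> simp [h]
  · simp only [vertexEquiv_inr, frameVector_otherVertex, idx_otherVertex]
    split_ifs with h <;> simp [h]

/-- The coordinates on the tangent space of `Θ` given by the components at all vertices other than
the first ones of the sets `V_j`. -/
def tangentThetaEquiv (F : VertexFlag V N) (o : FaceOrdering V) :
    F.tangentTheta ≃ₗ[ℝ] (F.ThetaIdx → ℝ) where
  toFun v a := (v : V → ℝ) (F.otherVertex o a)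
  map_add' _ _ := rfl
  map_smul' _ _ := rfl
  invFun s := ∑ a, s a • F.frameVector o a
  left_inv v := by
    classical
    ext i
    simp only [Submodule.coe_sum, Submodule.coe_smul, Finset.sum_apply, Pi.smul_apply, smul_eq_mul]
    obtain ⟨j | b, rfl⟩ := (F.vertexEquiv o).surjective i
    · -- The component at the first vertex is minus the sum of the others in the same set.
      have h := v.2 j
      rw [F.sum_block_eq o] at h
      simp only [vertexEquiv_inl, frameVector_baseVertex]
      rw [Fintype.sum_sigma, Finset.sum_eq_single j]
      · simp only [if_true, mul_neg, mul_one, Finset.sum_neg_distrib]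
        linarith
      · intro j' _ hj; simp [hj]
      · simp
    · simp [frameVector_otherVertex]
  right_inv s := by
    classical
    ext b
    simp [frameVector_otherVertex]

/-- The position of the frame vectors in the oriented frame of `Θ`. -/
def frameIdx {k : ℕ} (hV : Fintype.card V = N + k + 1) (F : VertexFlag V N) : Fin k ≃ F.ThetaIdx :=
  (finCongr (F.sum_card_sub_one hV)).trans finSigmaFinEquiv.symm

theorem thetaFrame_apply {k : ℕ} (hV : Fintype.card V = N + k + 1) (o : FaceOrdering V)
    (F : VertexFlag V N) (a : Fin k) :
    F.thetaFrame hV o a = F.frameVector o (F.frameIdx hV a) := rfl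

/-- The oriented frame of `Θ`, as a basis. -/
def frameBasis {k : ℕ} (hV : Fintype.card V = N + k + 1) (o : FaceOrdering V)
    (F : VertexFlag V N) : Module.Basis (Fin k) ℝ F.tangentTheta :=
  (Module.Basis.ofEquivFun (F.tangentThetaEquiv o)).reindex (F.frameIdx hV).symm

theorem coe_frameBasis {k : ℕ} (hV : Fintype.card V = N + k + 1) (o : FaceOrdering V)
    (F : VertexFlag V N) : ⇑(F.frameBasis hV o) = F.thetaFrame hV o := by
  classical
  ext a
  simp [frameBasis, thetaFrame_apply, tangentThetaEquiv, Pi.single_apply]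

theorem frameBasis_det {k : ℕ} (hV : Fintype.card V = N + k + 1) (o : FaceOrdering V)
    (F : VertexFlag V N) (v : Fin k → F.tangentTheta) :
    (F.frameBasis hV o).det v =
      Matrix.det (Matrix.of fun a b => (v b : V → ℝ) (F.otherVertex o (F.frameIdx hV a))) := by
  rw [Module.Basis.det_apply]
  congr 1

/-- The coordinate determinant vanishes on vectors that all have a zero component at a vertex `i`,
provided that `i` is not alone in its set. -/
theorem frameBasis_det_eq_zero {k : ℕ} (hV : Fintype.card V = N + k + 1) (o : FaceOrdering V)
    (F : VertexFlag V N) (v : Fin k → F.tangentTheta) {i i' : V} (hi : i ≠ i')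
    (hidx : F.idx i = F.idx i') (hv : ∀ b, (v b : V → ℝ) i = 0) :
    (F.frameBasis hV o).det v = 0 := by
  classical
  refine AlternatingMap.map_linearDependent _ _ fun hli => ?_
  have hspan : Submodule.span ℝ (Set.range v) = ⊤ := by
    apply hli.span_eq_top_of_card_eq_finrank'
    rw [Module.finrank_eq_card_basis (F.frameBasis hV o)]
  let w : F.tangentTheta := ⟨Pi.single i 1 - Pi.single i' 1, fun j => by
    simp only [Pi.sub_apply, Finset.sum_sub_distrib, Finset.sum_pi_single', block,
      Finset.mem_filter, Finset.mem_univ, true_and, hidx, sub_self]⟩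
  let φ : F.tangentTheta →ₗ[ℝ] ℝ := (LinearMap.proj i).comp F.tangentTheta.subtype
  have hφ : φ = 0 := by
    apply LinearMap.ext_on_range hspan
    intro b
    exact hv b
  have : φ w = 1 := by simp [φ, w, hi]
  rw [hφ] at this
  simp at this

end VertexFlag

section

variable {V : Type*} [Fintype V] {N k : ℕ}

/-! ### The volume form in quasi-cylindrical coordinates -/

/-- The rows `0`, `1, …, N` and `N + 1, …, N + k` of the determinant `dλ_V`, matched with the first
vertices of `V_0, …, V_N` and with the frame vectors of `Θ`. -/
def rowEquiv (hV : Fintype.card V = N + k + 1) (F : VertexFlag V N) :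
    Fin (N + k + 1) ≃ Fin (N + 1) ⊕ F.ThetaIdx :=
  ((finCongr (by omega : N + k + 1 = (N + 1) + k)).trans finSumFinEquiv.symm).trans
    (Equiv.sumCongr (Equiv.refl _) (F.frameIdx hV))

theorem rowEquiv_zero (hV : Fintype.card V = N + k + 1) (F : VertexFlag V N) :
    rowEquiv hV F 0 = Sum.inl 0 := by
  rw [← Equiv.eq_symm_apply]
  ext
  simp [rowEquiv]

theorem rowEquiv_castAdd (hV : Fintype.card V = N + k + 1) (F : VertexFlag V N) (a : Fin N) :
    rowEquiv hV F (Fin.castAdd k a).succ = Sum.inl a.succ := by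
  rw [← Equiv.eq_symm_apply]
  ext
  simp [rowEquiv]

theorem rowEquiv_natAdd (hV : Fintype.card V = N + k + 1) (F : VertexFlag V N) (b : Fin k) :
    rowEquiv hV F (Fin.natAdd N b).succ = Sum.inr (F.frameIdx hV b) := by
  rw [← Equiv.eq_symm_apply]
  ext
  simp [rowEquiv]
  omega

/-- The sign that compares the chosen ordering of all vertices with the ordering in which the first
vertices of `V_0, …, V_N` are followed by the other vertices of `V_0`, of `V_1`, and so on. -/
def orderSign (hV : Fintype.card V = N + k + 1) (o : FaceOrdering V) (F : VertexFlag V N) : ℝ :=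
  Matrix.det ((1 : Matrix (Fin (N + 1) ⊕ F.ThetaIdx) (Fin (N + 1) ⊕ F.ThetaIdx) ℝ).submatrix
    (rowEquiv hV F) ((topOrder hV o).trans (F.vertexEquiv o).symm))

theorem orderSign_mul_self (hV : Fintype.card V = N + k + 1) (o : FaceOrdering V)
    (F : VertexFlag V N) : orderSign hV o F * orderSign hV o F = 1 := by
  set τ := (topOrder hV o).trans (F.vertexEquiv o).symm with hτ
  have h : orderSign hV o F =
      Matrix.det ((1 : Matrix (Fin (N + 1) ⊕ F.ThetaIdx) (Fin (N + 1) ⊕ F.ThetaIdx) ℝ).submatrix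
        τ (rowEquiv hV F)) := by
    rw [orderSign, ← Matrix.det_transpose, Matrix.transpose_submatrix, Matrix.transpose_one]
  nth_rewrite 2 [h]
  rw [orderSign, ← Matrix.det_mul, Matrix.submatrix_mul_equiv, mul_one, Matrix.submatrix_one_equiv,
    Matrix.det_one]

/-- The determinant of the vectors `w_j = ∑_{i ∈ V_j} θ_i e_i` and of the frame of `Θ` is a sign
that does not depend on `θ`. -/
theorem det_frame (hV : Fintype.card V = N + k + 1) (o : FaceOrdering V) (F : VertexFlag V N)
    (θ : V → ℝ) (hθ : ∀ j, ∑ i ∈ F.block j, θ i = 1) :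
    Matrix.det (Matrix.of fun a b : Fin (N + k + 1) =>
      (Sum.elim (fun j => F.dPhiRadial θ (Pi.single j 1)) (fun c => (F.frameVector o c : V → ℝ))
        (rowEquiv hV F a)) (topOrder hV o b)) = orderSign hV o F := by
  classical
  set τ := (topOrder hV o).trans (F.vertexEquiv o).symm with hτ
  set T : Matrix (Fin (N + 1) ⊕ F.ThetaIdx) (Fin (N + 1) ⊕ F.ThetaIdx) ℝ :=
    Matrix.of fun p q => (Sum.elim (fun j => F.dPhiRadial θ (Pi.single j 1))
      (fun c => (F.frameVector o c : V → ℝ)) p) (F.vertexEquiv o q) with hT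
  have h1 : (Matrix.of fun a b : Fin (N + k + 1) =>
      (Sum.elim (fun j => F.dPhiRadial θ (Pi.single j 1)) (fun c => (F.frameVector o c : V → ℝ))
        (rowEquiv hV F a)) (topOrder hV o b)) = T.submatrix (rowEquiv hV F) τ := by
    ext a b
    simp [hT, hτ]
  have h2 : T = Matrix.fromBlocks (Matrix.diagonal fun j => θ (F.baseVertex o j))
      (Matrix.of fun j a => if a.1 = j then θ (F.otherVertex o a) else 0)
      (Matrix.of fun a j => if a.1 = j then -1 else 0) 1 := by
    ext p q
    rcases p with j | a <;> rcases q with j' | b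
    · simp only [hT, Matrix.of_apply, Sum.elim_inl, VertexFlag.vertexEquiv_inl,
        VertexFlag.dPhiRadial, VertexFlag.idx_baseVertex, Matrix.fromBlocks_apply₁₁,
        Matrix.diagonal_apply, Pi.single_apply, eq_comm (a := j')]
      split_ifs with h
      · rw [h, one_mul]
      · rw [zero_mul]
    · simp [hT, VertexFlag.dPhiRadial, Pi.single_apply]
    · simp [hT, VertexFlag.frameVector_baseVertex]
    · simp [hT, VertexFlag.frameVector_otherVertex, Matrix.one_apply]
  -- The Schur complement is diagonal with entries `∑_{i ∈ V_j} θ_i = 1`.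
  have h3 : T.det = 1 := by
    rw [h2, Matrix.det_fromBlocks_one₂₂]
    refine Eq.trans (congrArg Matrix.det ?_) (Matrix.det_one (n := Fin (N + 1)))
    ext j j'
    rw [Matrix.sub_apply, Matrix.mul_apply, Fintype.sum_sigma, Matrix.diagonal_apply,
      Matrix.one_apply]
    simp only [Matrix.of_apply]
    by_cases h : j = j'
    · subst h
      rw [Finset.sum_eq_single j]
      · have := hθ j
        rw [F.sum_block_eq o] at this
        simp only [if_true, mul_neg, mul_one, Finset.sum_neg_distrib]
        linarith
      · intro j' _ hj; simp [hj]
      · simp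
    · rw [if_neg h, if_neg h, Finset.sum_eq_zero, sub_zero]
      intro c _
      refine Finset.sum_eq_zero fun l _ => ?_
      by_cases hc : c = j
      · subst hc; simp [h]
      · simp [hc]
  have h4 : T.submatrix (rowEquiv hV F) τ = T.submatrix (rowEquiv hV F) (rowEquiv hV F) *
      (1 : Matrix (Fin (N + 1) ⊕ F.ThetaIdx) (Fin (N + 1) ⊕ F.ThetaIdx) ℝ).submatrix
        (rowEquiv hV F) τ := by
    rw [Matrix.submatrix_mul_equiv, mul_one]
  rw [h1, h4, Matrix.det_mul, Matrix.det_submatrix_equiv_self, h3, one_mul]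
  rfl

theorem sum_radialChart_mul (f : Fin (N + 1) → ℝ) (t : Fin N → ℝ) :
    ∑ j, radialChart t j * f j = f 0 + ∑ a, t a * (f a.succ - f 0) := by
  rw [Fin.sum_univ_succ]
  simp only [radialChart, Fin.cons_zero, Fin.cons_succ, mul_sub, Finset.sum_sub_distrib,
    ← Finset.sum_mul]
  ring

theorem prod_frame_radial (hV : Fintype.card V = N + k + 1) (F : VertexFlag V N)
    (r : Fin (N + 1) → ℝ) :
    ∏ b, r (F.frameIdx hV b).1 = ∏ j, r j ^ ((F.block j).card - 1) := by
  rw [(F.frameIdx hV).prod_comp (fun a => r a.1), Fintype.prod_sigma]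
  simp

/-- The pulled back volume form, evaluated on the frames of `R` and `Θ`. Elementary row operations
reduce the determinant to `det_frame`; the factors `r_j` come from the scaling of the tangent
vectors of `T_{V_j}` by `Φ`. -/
theorem fiberIntegrand_thetaFrame (hV : Fintype.card V = N + k + 1) (o : FaceOrdering V)
    (F : VertexFlag V N) (θ : V → ℝ) (hθ : ∀ j, ∑ i ∈ F.block j, θ i = 1) (t : Fin N → ℝ) :
    fiberIntegrand hV o F θ t (F.thetaFrame hV o) = ((N + k).factorial : ℝ) *
      ((∏ j, radialChart t j ^ ((F.block j).card - 1)) * orderSign hV o F) := by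
  set r := radialChart t with hr
  set w : Fin (N + 1) → V → ℝ := fun j => F.dPhiRadial θ (Pi.single j 1) with hw
  set f : Fin k → V → ℝ := fun b => (F.thetaFrame hV o b : V → ℝ) with hf
  set A : Matrix (Fin (N + k + 1)) V ℝ := Matrix.of (Fin.cons (F.Phi r θ) (Fin.append
    (fun a => F.dPhiRadial θ (radialFrame a))
    (fun b => (F.dPhiAngular r (F.thetaFrame hV o b) : V → ℝ)))) with hA
  set A₁ : Matrix (Fin (N + k + 1)) V ℝ := Matrix.of (Fin.cons (w 0) (Fin.append
    (fun a => w a.succ - w 0) (fun b => r (F.frameIdx hV b).1 • f b))) with hA₁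
  set A₂ : Matrix (Fin (N + k + 1)) V ℝ := Matrix.of (Fin.cons (w 0) (Fin.append
    (fun a => w a.succ) (fun b => r (F.frameIdx hV b).1 • f b))) with hA₂
  set A₃ : Matrix (Fin (N + k + 1)) V ℝ := Matrix.of (fun a => Sum.elim w
    (fun c => (F.frameVector o c : V → ℝ)) (rowEquiv hV F a)) with hA₃
  have hw_apply : ∀ j i, w j i = if F.idx i = j then θ i else 0 := by
    intro j i
    simp only [hw, VertexFlag.dPhiRadial, Pi.single_apply]
    split_ifs <;> simp
  have hPhi : ∀ i, F.Phi r θ i = w 0 i + ∑ a, t a * (w a.succ i - w 0 i) := by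
    intro i
    rw [← sum_radialChart_mul (fun j => w j i) t]
    simp [hw_apply, VertexFlag.Phi, hr]
  -- `Φ(r, θ) = w_0 + ∑ t_a (w_{a+1} - w_0)`: the sum is a combination of other rows.
  have e1 : (A.submatrix id (topOrder hV o)).det = (A₁.submatrix id (topOrder hV o)).det := by
    have h := Matrix.det_updateRow_sum (A₁.submatrix id (topOrder hV o)) 0
      (Fin.cons 1 (Fin.append t 0))
    rw [Fin.cons_zero, one_smul] at h
    rw [← h]
    congr 1
    ext a b
    rw [Matrix.updateRow_apply]
    refine Fin.cases ?_ (fun c => ?_) a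
    · rw [if_pos rfl, Fin.sum_univ_succ, Fin.sum_univ_add]
      simp [hA, hA₁, hPhi, Finset.sum_apply]
    · rw [if_neg (Fin.succ_ne_zero c)]
      refine Fin.addCases (fun c => ?_) (fun c => ?_) c
      · simp [hA, hA₁, hw, VertexFlag.dPhiRadial, radialFrame, sub_mul]
      · simp [hA, hA₁, hf, VertexFlag.dPhiAngular, VertexFlag.thetaFrame_apply,
          VertexFlag.mul_frameVector]
  -- Add the row `w_0` to the rows `w_{a+1} - w_0`.
  have e2 : (A₁.submatrix id (topOrder hV o)).det = (A₂.submatrix id (topOrder hV o)).det := by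
    refine Matrix.det_eq_of_forall_row_eq_smul_add_const
      (Fin.cons 0 (Fin.append (fun _ => -1) 0)) 0 rfl fun a b => ?_
    refine Fin.cases ?_ (fun c => ?_) a
    · simp [hA₁, hA₂]
    · refine Fin.addCases (fun c => ?_) (fun c => ?_) c
      · simp [hA₁, hA₂, sub_eq_add_neg]
      · simp [hA₁, hA₂]
  -- Extract the factors `r_j`.
  have e3 : (A₂.submatrix id (topOrder hV o)).det =
      (∏ j, r j ^ ((F.block j).card - 1)) * (A₃.submatrix id (topOrder hV o)).det := by
    have h := Matrix.det_mul_column (Fin.cons 1 (Fin.append (fun _ : Fin N => (1 : ℝ))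
      (fun b => r (F.frameIdx hV b).1))) (A₃.submatrix id (topOrder hV o))
    rw [Fin.prod_univ_succ, Fin.prod_univ_add] at h
    simp only [Fin.cons_zero, Fin.cons_succ, Fin.append_left, Fin.append_right,
      Finset.prod_const_one, one_mul, prod_frame_radial] at h
    rw [← h]
    congr 1
    ext a b
    refine Fin.cases ?_ (fun c => ?_) a
    · simp [hA₂, hA₃, rowEquiv_zero]
    · refine Fin.addCases (fun c => ?_) (fun c => ?_) c
      · simp [hA₂, hA₃, rowEquiv_castAdd]
      · simp [hA₂, hA₃, rowEquiv_natAdd, hf, VertexFlag.thetaFrame_apply]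
  have e4 : (A₃.submatrix id (topOrder hV o)).det = orderSign hV o F := det_frame hV o F θ hθ
  rw [← e4, ← e3, ← e2, ← e1]
  rfl

/-- The pulled back volume form, up to a sign: `Φ^* ω = n! ∏ j, r_j ^ (|V_j| - 1) dr ∧ vol`,
with `vol` the determinant in the oriented frame of `Θ`. -/
theorem fiberIntegrand_eq (hV : Fintype.card V = N + k + 1) (o : FaceOrdering V)
    (F : VertexFlag V N) (θ : V → ℝ) (hθ : ∀ j, ∑ i ∈ F.block j, θ i = 1) (t : Fin N → ℝ) :
    fiberIntegrand hV o F θ t = (((N + k).factorial : ℝ) *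
      ((∏ j, radialChart t j ^ ((F.block j).card - 1)) * orderSign hV o F)) •
        (F.frameBasis hV o).det := by
  conv_lhs => rw [AlternatingMap.eq_smul_basis_det (F.frameBasis hV o) (fiberIntegrand hV o F θ t)]
  rw [F.coe_frameBasis, fiberIntegrand_thetaFrame hV o F θ hθ]

/-- The orientation of `R` is the sign of `fiberIntegrand_thetaFrame` at the barycenter, where the
other factors are positive. -/
theorem radialSign_eq (hV : Fintype.card V = N + k + 1) (o : FaceOrdering V)
    (F : VertexFlag V N) : radialSign hV o F = orderSign hV o F := by
  have hr : (fun _ => 1 / ((N : ℝ) + 1)) = radialChart (fun _ : Fin N => 1 / ((N : ℝ) + 1)) := by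
    ext j
    refine Fin.cases ?_ (fun a => ?_) j
    · simp only [radialChart, Fin.cons_zero, Finset.sum_const, Finset.card_univ, Fintype.card_fin,
        nsmul_eq_mul]
      field_simp
      ring
    · simp [radialChart]
  have hθ : ∀ j, ∑ i ∈ F.block j, 1 / ((F.block (F.idx i)).card : ℝ) = 1 := by
    intro j
    have h : ∀ i ∈ F.block j, 1 / ((F.block (F.idx i)).card : ℝ) = 1 / ((F.block j).card : ℝ) := by
      intro i hi
      rw [(Finset.mem_filter.1 hi).2]
    rw [Finset.sum_congr rfl h, Finset.sum_const, nsmul_eq_mul]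
    exact mul_one_div_cancel (by exact_mod_cast (F.card_block_pos j).ne')
  have h := fiberIntegrand_thetaFrame hV o F _ hθ (fun _ : Fin N => 1 / ((N : ℝ) + 1))
  rw [radialSign]
  simp only [hr]
  change Real.sign (fiberIntegrand hV o F _ _ (F.thetaFrame hV o)) = _
  rw [h, ← hr, ← mul_assoc]
  have hpos : 0 < ((N + k).factorial : ℝ) *
      ∏ j : Fin (N + 1), (1 / ((N : ℝ) + 1)) ^ ((F.block j).card - 1) := by positivity
  rcases mul_self_eq_one_iff.1 (orderSign_mul_self hV o F) with h | h <;> rw [h]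
  · rw [mul_one]
    exact Real.sign_of_pos hpos
  · rw [mul_neg, mul_one, Real.sign_neg, Real.sign_of_pos hpos]

end

/-! ### Hyperplanes in the radial simplex -/

theorem continuous_radialChart {N : ℕ} :
    Continuous (fun t : Fin N → ℝ => (radialChart t : Fin (N + 1) → ℝ)) := by
  refine continuous_pi fun j => ?_
  refine Fin.cases ?_ (fun a => ?_) j
  · simp only [radialChart, Fin.cons_zero]; fun_prop
  · simp only [radialChart, Fin.cons_succ]; fun_prop

theorem volume_hyperplane {N : ℕ} {c : Fin (N + 1) → ℝ} (hc : c ≠ 0) :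
    volume {t : Fin N → ℝ | ∑ j, radialChart t j * c j = 0} = 0 := by
  let A : AffineSubspace ℝ (Fin N → ℝ) :=
    { carrier := {t | ∑ j, radialChart t j * c j = 0}
      smul_vsub_vadd_mem' := by
        intro x p q r hp hq hr
        simp only [Set.mem_ofPred_eq, sum_radialChart_mul, vsub_eq_sub, vadd_eq_add, Pi.add_apply,
          Pi.smul_apply, Pi.sub_apply, smul_eq_mul, add_mul, sub_mul, mul_assoc,
          Finset.sum_add_distrib, Finset.sum_sub_distrib, ← Finset.mul_sum] at hp hq hr ⊢
        linear_combination x * hp - x * hq + hr }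
  have hA : A ≠ ⊤ := by
    intro h
    have hmem : ∀ t : Fin N → ℝ, ∑ j, radialChart t j * c j = 0 := fun t => by
      have : t ∈ A := by rw [h]; trivial
      exact this
    simp only [sum_radialChart_mul] at hmem
    have h0 : c 0 = 0 := by simpa using hmem 0
    refine hc (funext fun j => ?_)
    refine Fin.cases h0 (fun a => ?_) j
    simpa [h0, Pi.single_apply] using hmem (Pi.single a 1)
  exact Measure.addHaar_affineSubspace volume A hA

/-! ### Dirichlet integrals -/

theorem integral_pow_mul_sub_pow (p m : ℕ) {s : ℝ} (hs : 0 ≤ s) :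
    ∫ x in (0 : ℝ)..s, x ^ p * (s - x) ^ m =
      s ^ (p + m + 1) * (p.factorial * m.factorial / (p + m + 1).factorial) := by
  rcases hs.eq_or_lt with rfl | hs
  · simp
  · have h := Complex.betaIntegral_scaled (p + 1 : ℂ) (m + 1 : ℂ) hs
    rw [Complex.betaIntegral_eq_Gamma_mul_div _ _ (by simp; positivity) (by simp; positivity)] at h
    have h1 : (p + 1 : ℂ) + (m + 1) = ((p + m + 1 : ℕ) : ℂ) + 1 := by push_cast; ring
    rw [h1] at h
    simp only [Complex.Gamma_nat_eq_factorial, add_sub_cancel_right, Complex.cpow_natCast] at h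
    have h2 : ((∫ x in (0 : ℝ)..s, x ^ p * (s - x) ^ m : ℝ) : ℂ) =
        ∫ x in (0 : ℝ)..s, (x : ℂ) ^ p * ((s : ℂ) - x) ^ m := by
      rw [← intervalIntegral.integral_ofReal]
      push_cast
      rfl
    rw [← h2] at h
    apply Complex.ofReal_injective
    rw [h]
    push_cast
    rfl

/-- The simplex `{t | 0 ≤ t, ∑ t ≤ s}`. -/
def cornerSimplex (N : ℕ) (s : ℝ) : Set (Fin N → ℝ) := {t | (∀ a, 0 ≤ t a) ∧ ∑ a, t a ≤ s}

theorem isClosed_cornerSimplex (N : ℕ) (s : ℝ) : IsClosed (cornerSimplex N s) := by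
  simp only [cornerSimplex, Set.ofPred_and, Set.ofPred_forall]
  exact (isClosed_iInter fun a => isClosed_le continuous_const (continuous_apply a)).inter
    (isClosed_le (by fun_prop) continuous_const)

theorem cornerSimplex_subset (N : ℕ) (s : ℝ) :
    cornerSimplex N s ⊆ Set.Icc 0 (fun _ => s) := by
  refine fun t ht => ⟨ht.1, fun a => ?_⟩
  exact (Finset.single_le_sum (f := t) (fun b _ => ht.1 b) (Finset.mem_univ a)).trans ht.2

theorem integrable_indicator_cornerSimplex (N : ℕ) (s : ℝ) {g : (Fin N → ℝ) → ℝ}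
    (hg : Continuous g) : Integrable ((cornerSimplex N s).indicator g) := by
  rw [integrable_indicator_iff (isClosed_cornerSimplex N s).measurableSet]
  exact hg.integrableOn_Icc.mono_set (cornerSimplex_subset N s)

/-- Dirichlet's integral, by induction on the dimension. -/
theorem integral_cornerSimplex (N : ℕ) (p : Fin N → ℕ) (q : ℕ) {s : ℝ} (hs : 0 ≤ s) :
    ∫ t, (cornerSimplex N s).indicator (fun t => (∏ a, t a ^ p a) * (s - ∑ a, t a) ^ q) t =
      s ^ (∑ a, p a + q + N) *
        ((∏ a, ((p a).factorial : ℝ)) * q.factorial / (∑ a, p a + q + N).factorial) := by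
  induction N generalizing s with
  | zero =>
    have h : (0 : Fin 0 → ℝ) ∈ cornerSimplex 0 s := ⟨fun a => a.elim0, by simpa using hs⟩
    rw [volume_pi, Measure.pi_of_empty (x := 0), integral_dirac, Set.indicator_of_mem h]
    have : (q.factorial : ℝ) ≠ 0 := by positivity
    simp [this]
  | succ N ih =>
    set g : (Fin (N + 1) → ℝ) → ℝ := fun t => (∏ a, t a ^ p a) * (s - ∑ a, t a) ^ q with hg
    have hmp := (volume_preserving_piFinSuccAbove (fun _ : Fin (N + 1) => ℝ) 0).symm
    have hint : Integrable ((cornerSimplex (N + 1) s).indicator g) :=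
      integrable_indicator_cornerSimplex _ _ (by fun_prop)
    rw [← hmp.integral_comp', Measure.volume_eq_prod, integral_prod]
    swap
    · exact (hmp.integrable_comp_emb (MeasurableEquiv.measurableEmbedding _)).2 hint
    have hcons : ∀ (x : ℝ) (t : Fin N → ℝ),
        (MeasurableEquiv.piFinSuccAbove (fun _ : Fin (N + 1) => ℝ) 0).symm (x, t) =
          Fin.cons x t := by
      intro x t
      exact Fin.insertNth_zero' x t
    simp only [hcons]
    -- Integrating over the last `N` variables gives the integral for the simplex of size `s - x`.
    have hinner : ∀ x : ℝ, (∫ t : Fin N → ℝ, (cornerSimplex (N + 1) s).indicator g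
        (Fin.cons x t)) =
        (Set.Icc 0 s).indicator (fun x => x ^ p 0 * (s - x) ^ (∑ a : Fin N, p a.succ + q + N) *
          ((∏ a : Fin N, ((p a.succ).factorial : ℝ)) * q.factorial /
            (∑ a : Fin N, p a.succ + q + N).factorial)) x := by
      intro x
      by_cases hx : x ∈ Set.Icc 0 s
      · rw [Set.indicator_of_mem hx, mul_assoc, ← ih (fun a => p a.succ) (sub_nonneg.2 hx.2),
          ← integral_const_mul]
        congr 1
        ext t
        have hiff : (Fin.cons x t ∈ cornerSimplex (N + 1) s) ↔ t ∈ cornerSimplex N (s - x) := by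
          simp only [cornerSimplex, Set.mem_ofPred_eq, Fin.forall_fin_succ, Fin.sum_univ_succ,
            Fin.cons_zero, Fin.cons_succ, hx.1, true_and, le_sub_iff_add_le']
        by_cases ht : t ∈ cornerSimplex N (s - x)
        · rw [Set.indicator_of_mem ht, Set.indicator_of_mem (hiff.2 ht)]
          simp only [hg, Fin.prod_univ_succ, Fin.sum_univ_succ,
            Fin.cons_zero, Fin.cons_succ]
          rw [sub_add_eq_sub_sub]
          ring
        · rw [Set.indicator_of_notMem ht, Set.indicator_of_notMem (mt hiff.1 ht), mul_zero]
      · rw [Set.indicator_of_notMem hx]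
        rw [integral_eq_zero_of_ae]
        refine Eventually.of_forall fun t => Set.indicator_of_notMem (fun ht => hx ?_) _
        have h0 := ht.1 0
        have h1 := (cornerSimplex_subset _ _ ht).2 0
        rw [Fin.cons_zero] at h0 h1
        exact ⟨h0, h1⟩
    simp only [hinner]
    rw [integral_indicator measurableSet_Icc, integral_Icc_eq_integral_Ioc,
      ← intervalIntegral.integral_of_le hs, intervalIntegral.integral_mul_const,
      integral_pow_mul_sub_pow _ _ hs]
    have he : p 0 + (∑ a : Fin N, p a.succ + q + N) + 1 = ∑ a, p a + q + (N + 1) := by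
      rw [Fin.sum_univ_succ]; ring
    rw [he, Fin.prod_univ_succ]
    have : ((∑ a : Fin N, p a.succ + q + N).factorial : ℝ) ≠ 0 := by positivity
    field_simp

theorem radialChart_mem_stdSimplex {N : ℕ} (t : Fin N → ℝ) :
    radialChart t ∈ stdSimplex ℝ (Fin (N + 1)) ↔ t ∈ cornerSimplex N 1 := by
  simp only [stdSimplex, cornerSimplex, Set.mem_ofPred_eq, Fin.forall_fin_succ, Fin.sum_univ_succ,
    radialChart, Fin.cons_zero, Fin.cons_succ, sub_add_cancel, and_true, sub_nonneg]
  exact and_comm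

/-- Dirichlet's integral over the simplex in barycentric coordinates. -/
theorem integral_radialChart_stdSimplex {N : ℕ} (p : Fin (N + 1) → ℕ) :
    ∫ t in {t : Fin N → ℝ | radialChart t ∈ stdSimplex ℝ (Fin (N + 1))},
      ∏ j, radialChart t j ^ p j =
        (∏ j, ((p j).factorial : ℝ)) / (∑ j, p j + N).factorial := by
  have hS : {t : Fin N → ℝ | radialChart t ∈ stdSimplex ℝ (Fin (N + 1))} = cornerSimplex N 1 :=
    Set.ext radialChart_mem_stdSimplex
  have h := integral_cornerSimplex N (fun a => p a.succ) (p 0) zero_le_one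
  rw [integral_indicator (isClosed_cornerSimplex N 1).measurableSet, one_pow, one_mul] at h
  rw [hS, Fin.prod_univ_succ, Fin.sum_univ_succ, mul_comm, add_comm (p 0), ← h]
  congr 1
  ext t
  rw [Fin.prod_univ_succ, mul_comm]
  simp [radialChart]

theorem ae_radialChart_ne_zero {N : ℕ} : ∀ᵐ t : Fin N → ℝ, ∀ j, radialChart t j ≠ 0 := by
  rw [ae_all_iff]
  intro j
  have h : (Pi.single j 1 : Fin (N + 1) → ℝ) ≠ 0 := by simp
  have := volume_hyperplane h
  rw [ae_iff]
  simpa [Pi.single_apply] using this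

/-- The volume of the open simplex is Dirichlet's integral with all exponents zero. -/
theorem volume_open_cornerSimplex (m : ℕ) :
    volume {t : Fin m → ℝ | (∀ a, 0 < t a) ∧ ∑ a, t a < 1} =
      ENNReal.ofReal (1 / m.factorial) := by
  have h1 : {t : Fin m → ℝ | (∀ a, 0 < t a) ∧ ∑ a, t a < 1} =ᵐ[volume] cornerSimplex m 1 := by
    filter_upwards [ae_radialChart_ne_zero] with t ht
    have h0 := ht 0
    have hs := fun a : Fin m => ht a.succ
    simp only [radialChart, Fin.cons_zero, Fin.cons_succ] at h0 hs
    apply propext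
    constructor
    · exact fun h => ⟨fun a => (h.1 a).le, h.2.le⟩
    · exact fun h => ⟨fun a => (h.1 a).lt_of_ne (hs a).symm,
        h.2.lt_of_ne fun h' => h0 (by rw [h', sub_self])⟩
  have h2 := integral_cornerSimplex m (fun _ => 0) 0 zero_le_one
  rw [integral_indicator (isClosed_cornerSimplex m 1).measurableSet] at h2
  simp at h2
  have hfin : volume (cornerSimplex m 1) ≠ ⊤ :=
    ((measure_mono (cornerSimplex_subset m 1)).trans_lt isCompact_Icc.measure_lt_top).ne
  rw [measure_congr h1, one_div, ← h2, ofReal_measureReal hfin]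

/-- Currying the coordinates of a finite product of finite powers of `ℝ` preserves the volume. -/
theorem volume_preserving_piCurry {ι : Type*} [Fintype ι] (κ : ι → Type*) [∀ i, Fintype (κ i)] :
    MeasurePreserving (MeasurableEquiv.piCurry (fun (i : ι) (_ : κ i) => ℝ)).symm := by
  refine ⟨MeasurableEquiv.measurable _, ?_⟩
  refine (Measure.pi_eq fun s _ => ?_).symm
  rw [MeasurableEquiv.map_apply, Fintype.prod_sigma]
  have : (MeasurableEquiv.piCurry (fun (i : ι) (_ : κ i) => ℝ)).symm ⁻¹' (Set.univ.pi s) =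
      Set.univ.pi fun i => Set.univ.pi fun l => s ⟨i, l⟩ := by
    ext f
    simp [MeasurableEquiv.coe_piCurry_symm, Sigma.uncurry, Set.mem_pi, Sigma.forall]
  rw [this, volume_pi_pi]
  refine Finset.prod_congr rfl fun i _ => ?_
  rw [volume_pi_pi]

/-- The volume of a product of simplices. -/
theorem volume_prod_cornerSimplex {n : ℕ} (m : Fin n → ℕ) :
    volume {s : ((j : Fin n) × Fin (m j)) → ℝ | ∀ j, (∀ l, 0 < s ⟨j, l⟩) ∧ ∑ l, s ⟨j, l⟩ < 1} =
      ENNReal.ofReal (∏ j, 1 / ((m j).factorial : ℝ)) := by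
  rw [← (volume_preserving_piCurry fun j => Fin (m j)).measure_preimage_equiv]
  have : (MeasurableEquiv.piCurry (fun (j : Fin n) (_ : Fin (m j)) => ℝ)).symm ⁻¹'
      {s | ∀ j, (∀ l, 0 < s ⟨j, l⟩) ∧ ∑ l, s ⟨j, l⟩ < 1} =
      Set.univ.pi fun j => {t : Fin (m j) → ℝ | (∀ a, 0 < t a) ∧ ∑ a, t a < 1} := by
    ext f
    simp [MeasurableEquiv.coe_piCurry_symm, Sigma.uncurry, Set.mem_pi]
  rw [this, volume_pi_pi, ENNReal.ofReal_prod_of_nonneg fun j _ => by positivity]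
  exact Finset.prod_congr rfl fun j _ => volume_open_cornerSimplex (m j)

/-! ### Integrals over regions cut out by ratio bounds -/

/-- The points `t` of the chart of `R` whose barycentric coordinates `r` satisfy
`r_j (1 - τ_{j j'}) ≤ r_{j'} τ_{j j'}` for `j < j'`. -/
def ratioRegion {N : ℕ} (τ : Fin (N + 1) → Fin (N + 1) → ℝ) : Set (Fin N → ℝ) :=
  {t | ∀ j j', j < j' → radialChart t j * (1 - τ j j') ≤ radialChart t j' * τ j j'}

/-- The integral of `∏ j, r_j ^ p_j` over the points `r` of `R` in `ratioRegion τ`. For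
`τ_{j j'} = ρ_j / (ρ_j + ρ_{j'})` this is the integral over `R_ρ`, but here the
degenerate ratios `τ_{j j'} = 0, 1` are allowed. -/
def ratioIntegral {N : ℕ} (p : Fin (N + 1) → ℕ) (τ : Fin (N + 1) → Fin (N + 1) → ℝ) : ℝ :=
  ∫ t in {t : Fin N → ℝ | radialChart t ∈ stdSimplex ℝ (Fin (N + 1))},
    (ratioRegion τ).indicator (fun t => ∏ j, radialChart t j ^ p j) t

theorem measurableSet_radialChart_stdSimplex {N : ℕ} :
    MeasurableSet {t : Fin N → ℝ | radialChart t ∈ stdSimplex ℝ (Fin (N + 1))} :=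
  ((isClosed_stdSimplex ℝ (Fin (N + 1))).preimage continuous_radialChart).measurableSet

theorem measurableSet_ratioRegion {N : ℕ} (τ : Fin (N + 1) → Fin (N + 1) → ℝ) :
    MeasurableSet (ratioRegion τ) := by
  have hc : ∀ j, Continuous fun t : Fin N → ℝ => radialChart t j := fun j =>
    (continuous_apply j).comp continuous_radialChart
  simp only [ratioRegion, Set.ofPred_forall]
  exact (isClosed_iInter fun j => isClosed_iInter fun j' => isClosed_iInter fun _ =>
    isClosed_le ((hc j).mul continuous_const) ((hc j').mul continuous_const)).measurableSet

/-- The hyperplane that bounds a ratio condition is not all of `R`, even for degenerate ratios. -/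
theorem ae_ratio_ne {N : ℕ} (τ : Fin (N + 1) → Fin (N + 1) → ℝ) :
    ∀ᵐ t : Fin N → ℝ, ∀ j j', j < j' →
      radialChart t j * (1 - τ j j') ≠ radialChart t j' * τ j j' := by
  rw [ae_all_iff]; intro j
  rw [ae_all_iff]; intro j'
  by_cases hj : j < j'
  · have h : (Pi.single j (1 - τ j j') - Pi.single j' (τ j j') : Fin (N + 1) → ℝ) ≠ 0 := by
      intro h
      have h1 := congrFun h j
      have h2 := congrFun h j'
      simp [hj.ne] at h1
      simp [hj.ne'] at h2
      rw [h2] at h1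
      simp at h1
    have := volume_hyperplane h
    rw [ae_iff]
    simpa [hj, mul_sub, Pi.single_apply, sub_eq_zero] using this
  · exact Eventually.of_forall fun t h => absurd h hj

theorem continuous_ratioIntegral {N : ℕ} (p : Fin (N + 1) → ℕ) :
    Continuous (ratioIntegral p) := by
  have hc : ∀ j, Continuous fun t : Fin N → ℝ => radialChart t j := fun j =>
    (continuous_apply j).comp continuous_radialChart
  have hg : Continuous fun t : Fin N → ℝ => ∏ j, radialChart t j ^ p j :=
    continuous_finsetProd _ fun j _ => (hc j).pow _
  have hS : {t : Fin N → ℝ | radialChart t ∈ stdSimplex ℝ (Fin (N + 1))} = cornerSimplex N 1 :=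
    Set.ext radialChart_mem_stdSimplex
  rw [continuous_iff_continuousAt]
  intro τ₀
  refine continuousAt_of_dominated (bound := fun t => ‖∏ j, radialChart t j ^ p j‖) ?_ ?_ ?_ ?_
  · exact Eventually.of_forall fun τ =>
      (hg.measurable.indicator (measurableSet_ratioRegion τ)).aestronglyMeasurable
  · exact Eventually.of_forall fun τ => Eventually.of_forall fun t =>
      norm_indicator_le_norm_self _ _
  · rw [hS]
    exact (hg.norm.integrableOn_Icc).mono_set (cornerSimplex_subset N 1)
  · filter_upwards [ae_restrict_of_ae (ae_ratio_ne τ₀)] with t ht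
    -- Off the bounding hyperplanes, the indicator is locally constant as a function of `τ`.
    have hev : ∀ᶠ τ in 𝓝 τ₀, (t ∈ ratioRegion τ ↔ t ∈ ratioRegion τ₀) := by
      have : ∀ᶠ τ : Fin (N + 1) → Fin (N + 1) → ℝ in 𝓝 τ₀, ∀ j j', j < j' →
          (radialChart t j * (1 - τ j j') ≤ radialChart t j' * τ j j' ↔
            radialChart t j * (1 - τ₀ j j') ≤ radialChart t j' * τ₀ j j') := by
        rw [eventually_all]; intro j
        rw [eventually_all]; intro j'
        by_cases hj : j < j'
        · have c1 : Continuous fun τ : Fin (N + 1) → Fin (N + 1) → ℝ =>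
              radialChart t j * (1 - τ j j') := by fun_prop
          have c2 : Continuous fun τ : Fin (N + 1) → Fin (N + 1) → ℝ =>
              radialChart t j' * τ j j' := by fun_prop
          rcases lt_or_gt_of_ne (ht j j' hj) with h | h
          · filter_upwards [c1.continuousAt.eventually_lt c2.continuousAt h] with τ hτ _
            exact iff_of_true hτ.le h.le
          · filter_upwards [c2.continuousAt.eventually_lt c1.continuousAt h] with τ hτ _
            exact iff_of_false hτ.not_ge h.not_ge
        · exact Eventually.of_forall fun τ h => absurd h hj
      filter_upwards [this] with τ hτ
      exact forall_congr' fun j => forall_congr' fun j' => forall_congr' fun hj => hτ j j' hj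
    refine (continuousAt_const (y := (ratioRegion τ₀).indicator
      (fun t => ∏ j, radialChart t j ^ p j) t)).congr ?_
    filter_upwards [hev] with τ hτ
    by_cases h : t ∈ ratioRegion τ₀
    · rw [Set.indicator_of_mem h, Set.indicator_of_mem (hτ.2 h)]
    · rw [Set.indicator_of_notMem h, Set.indicator_of_notMem (mt hτ.1 h)]

theorem integral_radialRegion {N : ℕ} (p : Fin (N + 1) → ℕ) {ρ : Fin (N + 1) → ℝ}
    (hρ : ∀ j, 0 < ρ j) :
    ∫ t in {t : Fin N → ℝ | radialChart t ∈ radialRegion ρ}, ∏ j, radialChart t j ^ p j =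
      ratioIntegral p (fun j j' => ρ j / (ρ j + ρ j')) := by
  rw [ratioIntegral, setIntegral_indicator (measurableSet_ratioRegion _)]
  congr 2
  ext t
  simp only [radialRegion, ratioRegion, Set.mem_ofPred_eq, Set.mem_inter_iff]
  refine and_congr_right fun _ => ?_
  have key : ∀ j j', radialChart t j / ρ j ≤ radialChart t j' / ρ j' ↔
      radialChart t j * (1 - ρ j / (ρ j + ρ j')) ≤ radialChart t j' * (ρ j / (ρ j + ρ j')) := by
    intro j j'
    have h1 := hρ j
    have h2 := hρ j'
    have h3 : 1 - ρ j / (ρ j + ρ j') = ρ j' / (ρ j + ρ j') := by field_simp; ring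
    rw [div_le_div_iff₀ h1 h2, h3, ← mul_div_assoc, ← mul_div_assoc,
      div_le_div_iff_of_pos_right (add_pos h1 h2)]
  constructor
  · exact fun h j j' hj => (key j j').1 (h j j' hj.le)
  · intro h j j' hj
    rcases hj.eq_or_lt with rfl | hj
    · exact le_rfl
    · exact (key j j').2 (h j j' hj)

/-- If all ratios are `1`, every ratio condition reads `0 ≤ r_{j'}`, and the region of integration
is the whole simplex. -/
theorem ratioIntegral_of_eq_one {N : ℕ} (p : Fin (N + 1) → ℕ)
    {τ : Fin (N + 1) → Fin (N + 1) → ℝ} (hτ : ∀ j j', j < j' → τ j j' = 1) :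
    ratioIntegral p τ = (∏ j, ((p j).factorial : ℝ)) / (∑ j, p j + N).factorial := by
  rw [← integral_radialChart_stdSimplex, ratioIntegral]
  refine setIntegral_congr_fun measurableSet_radialChart_stdSimplex fun t ht => ?_
  refine Set.indicator_of_mem ?_ _
  intro j j' hj
  rw [hτ j j' hj, sub_self, mul_zero, mul_one]
  exact ht.1 j'

/-- If a ratio is `0`, the region of integration lies in the hyperplane `r_j = 0`. -/
theorem ratioIntegral_of_eq_zero {N : ℕ} (p : Fin (N + 1) → ℕ)
    {τ : Fin (N + 1) → Fin (N + 1) → ℝ} {j j' : Fin (N + 1)} (hj : j < j') (hτ : τ j j' = 0) :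
    ratioIntegral p τ = 0 := by
  refine integral_eq_zero_of_ae ?_
  filter_upwards [ae_restrict_of_ae ae_radialChart_ne_zero,
    ae_restrict_mem measurableSet_radialChart_stdSimplex] with t h0 ht
  refine Set.indicator_of_notMem (fun h => h0 j (le_antisymm ?_ (ht.1 j))) _
  simpa [hτ] using h j j' hj

/-! ### Iterated limits -/

/-- `HasIteratedLimit` for functions with values in an arbitrary topological space. -/
def HasIterLim {N : ℕ} {X : Type*} [TopologicalSpace X] (g : ↥(openSimplex (Fin (N + 1))) → X)
    (c : X) : Prop :=
  ∃ G : ∀ m : ℕ, ↥(openFace N m) → X,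
    (∀ ρ (h : ρ ∈ openFace N N) (h' : ρ ∈ openSimplex (Fin (N + 1))), G N ⟨ρ, h⟩ = g ⟨ρ, h'⟩) ∧
    (∀ m, m < N → ∀ ρ : ↥(openFace N m),
      Tendsto (G (m + 1)) (comap Subtype.val (𝓝 (ρ : Fin (N + 1) → ℝ))) (𝓝 (G m ρ))) ∧
    ∀ ρ : ↥(openFace N 0), G 0 ρ = c

theorem hasIteratedLimit_iff {N : ℕ} {g : ↥(openSimplex (Fin (N + 1))) → ℝ} {c : ℝ} :
    HasIteratedLimit g c ↔ HasIterLim g c := Iff.rfl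

section HasIterLim

variable {N : ℕ} {X Y : Type*} [TopologicalSpace X] [TopologicalSpace Y]

theorem HasIterLim.comp {g : ↥(openSimplex (Fin (N + 1))) → X} {c : X} {f : X → Y}
    (hf : Continuous f) (h : HasIterLim g c) : HasIterLim (fun ρ => f (g ρ)) (f c) := by
  obtain ⟨G, h1, h2, h3⟩ := h
  exact ⟨fun m ρ => f (G m ρ), fun ρ h h' => congrArg f (h1 ρ h h'),
    fun m hm ρ => (hf.tendsto _).comp (h2 m hm ρ), fun ρ => congrArg f (h3 ρ)⟩

theorem HasIterLim.pi {ι : Type*} {X : ι → Type*} [∀ i, TopologicalSpace (X i)]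
    {g : ∀ i, ↥(openSimplex (Fin (N + 1))) → X i} {c : ∀ i, X i}
    (h : ∀ i, HasIterLim (g i) (c i)) : HasIterLim (fun ρ i => g i ρ) c := by
  choose G h1 h2 h3 using h
  exact ⟨fun m ρ i => G i m ρ, fun ρ h h' => funext fun i => h1 i ρ h h',
    fun m hm ρ => tendsto_pi_nhds.2 fun i => h2 i m hm ρ, fun ρ => funext fun i => h3 i ρ⟩

theorem HasIterLim.prodMk {g : ↥(openSimplex (Fin (N + 1))) → X} {c : X}
    {g' : ↥(openSimplex (Fin (N + 1))) → Y} {c' : Y}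
    (h : HasIterLim g c) (h' : HasIterLim g' c') : HasIterLim (fun ρ => (g ρ, g' ρ)) (c, c') := by
  obtain ⟨G, h1, h2, h3⟩ := h
  obtain ⟨G', h1', h2', h3'⟩ := h'
  exact ⟨fun m ρ => (G m ρ, G' m ρ), fun ρ h h' => Prod.ext (h1 ρ h h') (h1' ρ h h'),
    fun m hm ρ => (h2 m hm ρ).prodMk_nhds (h2' m hm ρ), fun ρ => Prod.ext (h3 ρ) (h3' ρ)⟩

/-- The limit `ρ_{m+1} → 0` is taken at accumulation points, so that it is unique. -/
theorem openFace_subset_closure {m : ℕ} (hm : m < N) :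
    openFace N m ⊆ closure (openFace N (m + 1)) := by
  intro ρ hρ
  let e : Fin (N + 1) := ⟨m + 1, by omega⟩
  have he : (0 : Fin (N + 1)) ≠ e := fun h => by simpa [e] using congrArg Fin.val h
  -- Move a small amount of mass from the vertex `0` to the vertex `m + 1`.
  let p : ℝ → Fin (N + 1) → ℝ := fun ε => ρ + ε • (Pi.single e 1 - Pi.single 0 1)
  have hp : Tendsto p (𝓝[>] 0) (𝓝 ρ) := by
    have : Continuous p := by fun_prop
    have h := this.tendsto 0
    simp only [p, zero_smul, add_zero] at h
    exact h.mono_left nhdsWithin_le_nhds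
  refine mem_closure_of_tendsto hp ?_
  filter_upwards [Ioo_mem_nhdsGT (hρ.1 0 (by simp))] with ε hε
  refine ⟨fun j hj => ?_, fun j hj => ?_, ?_⟩
  · by_cases h0 : j = 0
    · subst h0
      simp [p, he, hε.2]
    · by_cases hje : j = e
      · subst hje
        simp [p, h0, hρ.2.1 e (by simp [e]), hε.1]
      · have : (j : ℕ) ≤ m := by
          have : (j : ℕ) ≠ m + 1 := fun h => hje (Fin.ext h)
          omega
        simpa [p, Pi.single_apply, h0, hje] using hρ.1 j this
  · have h0 : j ≠ 0 := by rintro rfl; simp at hj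
    have hje : j ≠ e := by rintro rfl; simp [e] at hj
    simpa [p, Pi.single_apply, h0, hje] using hρ.2.1 j (by omega)
  · simp only [p, Pi.add_apply, Pi.smul_apply, Pi.sub_apply, smul_eq_mul, Finset.sum_add_distrib,
      ← Finset.mul_sum, Finset.sum_sub_distrib, hρ.2.2]
    simp

theorem mem_openSimplex_of_mem_openFace {ρ : Fin (N + 1) → ℝ} (h : ρ ∈ openFace N N) :
    ρ ∈ openSimplex (Fin (N + 1)) :=
  ⟨fun j => h.1 j (by omega), h.2.2⟩

theorem HasIterLim.unique [T2Space X] {g : ↥(openSimplex (Fin (N + 1))) → X} {c c' : X}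
    (h : HasIterLim g c) (h' : HasIterLim g c') : c = c' := by
  obtain ⟨G, h1, h2, h3⟩ := h
  obtain ⟨G', h1', h2', h3'⟩ := h'
  -- Uniqueness propagates from the face with vertices `0, …, N` down to the vertex `0`.
  have key : ∀ d m, m + d = N → G m = G' m := by
    intro d
    induction d with
    | zero =>
      intro m hm
      obtain rfl : m = N := by omega
      ext ⟨ρ, hρ⟩
      rw [h1 ρ hρ (mem_openSimplex_of_mem_openFace hρ), h1' ρ hρ]
    | succ d ih =>
      intro m hm
      ext ρ
      have hlt : m < N := by omega
      have hne := mem_closure_iff_comap_neBot.1 (openFace_subset_closure hlt ρ.2)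
      have ht := h2 m hlt ρ
      rw [ih (m + 1) (by omega)] at ht
      exact tendsto_nhds_unique ht (h2' m hlt ρ)
  have h0 : (Pi.single 0 1 : Fin (N + 1) → ℝ) ∈ openFace N 0 := by
    refine ⟨fun j hj => ?_, fun j hj => ?_, by simp⟩
    · have : j = 0 := Fin.ext (by simpa using hj)
      simp [this]
    · have : j ≠ 0 := by rintro rfl; simp at hj
      simp [this]
  rw [← h3 ⟨_, h0⟩, ← h3' ⟨_, h0⟩, key N 0 (zero_add N)]

/-- The basic iterated limit: a ratio of linear forms in `ρ`, in which the denominator has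
nonnegative coefficients, the first positive one at `m₀`. The ratio extends continuously to the open
faces with vertices `0, …, m` for `m ≥ m₀`. On the face with `m = m₀` only the coefficients at `m₀`
contribute, so that the ratio is constant there and the further limits do not change it. -/
theorem hasIterLim_ratio {A C : Fin (N + 1) → ℝ} (hC : ∀ m, 0 ≤ C m) {m₀ : Fin (N + 1)}
    (hm₀ : 0 < C m₀) (hA0 : ∀ m < m₀, A m = 0) (hC0 : ∀ m < m₀, C m = 0) :
    HasIterLim (fun ρ : ↥(openSimplex (Fin (N + 1))) =>
      (∑ m, (ρ : Fin (N + 1) → ℝ) m * A m) / ∑ m, (ρ : Fin (N + 1) → ℝ) m * C m)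
      (A m₀ / C m₀) := by
  have hconst : ∀ ρ ∈ openFace N m₀, (∑ m, ρ m * A m) / ∑ m, ρ m * C m = A m₀ / C m₀ := by
    intro ρ hρ
    have hsum : ∀ B : Fin (N + 1) → ℝ, (∀ m < m₀, B m = 0) → ∑ m, ρ m * B m = ρ m₀ * B m₀ := by
      intro B hB
      refine Finset.sum_eq_single m₀ (fun m _ hm => ?_) (by simp)
      rcases lt_or_gt_of_ne hm with h | h
      · rw [hB m h, mul_zero]
      · rw [hρ.2.1 m h, zero_mul]
    rw [hsum A hA0, hsum C hC0, mul_div_mul_left _ _ (hρ.1 m₀ le_rfl).ne']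
  refine ⟨fun m ρ => if (m₀ : ℕ) ≤ m then (∑ m, (ρ : Fin (N + 1) → ℝ) m * A m) /
    ∑ m, (ρ : Fin (N + 1) → ℝ) m * C m else A m₀ / C m₀, ?_, ?_, ?_⟩
  · intro ρ h h'
    simp only [if_pos (Nat.lt_succ_iff.1 m₀.2)]
  · intro m hm ρ
    by_cases h : (m₀ : ℕ) ≤ m
    · simp only [if_pos h, if_pos (Nat.le_succ_of_le h)]
      have hpos : 0 < ∑ m, (ρ : Fin (N + 1) → ℝ) m * C m := by
        refine Finset.sum_pos' (fun j _ => mul_nonneg ?_ (hC j))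
          ⟨m₀, Finset.mem_univ _, mul_pos (ρ.2.1 m₀ h) hm₀⟩
        rcases le_or_gt (j : ℕ) m with hj | hj
        · exact (ρ.2.1 j hj).le
        · exact (ρ.2.2.1 j hj).ge
      have hcont : ContinuousAt (fun ρ : Fin (N + 1) → ℝ =>
          (∑ m, ρ m * A m) / ∑ m, ρ m * C m) ρ :=
        (Continuous.continuousAt (by fun_prop)).div (Continuous.continuousAt (by fun_prop)) hpos.ne'
      exact hcont.tendsto.comp tendsto_comap
    · simp only [if_neg h]
      refine tendsto_const_nhds.congr fun ρ' => ?_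
      split_ifs with h'
      · have hm' : (m₀ : ℕ) = m + 1 := by omega
        refine (hconst ρ' ?_).symm
        rw [hm']
        exact ρ'.2
      · rfl
  · intro ρ
    dsimp only
    split_ifs with h
    · refine hconst ρ ?_
      rw [Nat.le_zero.1 h]
      exact ρ.2
    · rfl

end HasIterLim

section

variable {V : Type*} [Fintype V] {N k : ℕ}

/-! ### Blow-up Whitney forms in coordinates -/

theorem psiRadial_eq (hV : Fintype.card V = N + k + 1) (o : FaceOrdering V) (F : VertexFlag V N)
    {ρ : Fin (N + 1) → ℝ} (hρ : ∀ j, 0 < ρ j) {θ : V → ℝ}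
    (hθ : ∀ j, ∑ i ∈ F.block j, θ i = 1) :
    psiRadial hV o F ρ θ = (((N + k).factorial : ℝ) *
      ratioIntegral (fun j => (F.block j).card - 1) (fun j j' => ρ j / (ρ j + ρ j'))) •
        (F.frameBasis hV o).det := by
  ext Y
  have h : ∀ t, fiberIntegrand hV o F θ t Y = (∏ j, radialChart t j ^ ((F.block j).card - 1)) *
      ((N + k).factorial * orderSign hV o F * (F.frameBasis hV o).det Y) := by
    intro t
    rw [fiberIntegrand_eq hV o F θ hθ]
    simp only [AlternatingMap.smul_apply, smul_eq_mul]
    ring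
  change radialSign hV o F * (∫ t in {t : Fin N → ℝ | radialChart t ∈ radialRegion ρ},
    fiberIntegrand hV o F θ t Y) = _
  simp only [h]
  rw [integral_mul_const, integral_radialRegion (fun j => (F.block j).card - 1) hρ, radialSign_eq]
  simp only [AlternatingMap.smul_apply, smul_eq_mul]
  linear_combination (ratioIntegral (fun j => (F.block j).card - 1)
    (fun j j' => ρ j / (ρ j + ρ j')) * (N + k).factorial * (F.frameBasis hV o).det Y) *
      orderSign_mul_self hV o F

theorem rho_pos (F : VertexFlag V N) {x : V → ℝ} (hx : ∀ i, 0 < x i) (j : Fin (N + 1)) :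
    0 < F.rho x j :=
  Finset.sum_pos (fun i _ => hx i) (Finset.card_pos.1 (F.card_block_pos j))

theorem sum_block_theta (F : VertexFlag V N) {x : V → ℝ} (hx : ∀ i, 0 < x i) (j : Fin (N + 1)) :
    ∑ i ∈ F.block j, F.theta x i = 1 := by
  have h : ∀ i ∈ F.block j, F.theta x i = x i / F.rho x j := by
    intro i hi
    rw [VertexFlag.theta, (Finset.mem_filter.1 hi).2]
  rw [Finset.sum_congr rfl h, ← Finset.sum_div]
  exact div_self (rho_pos F hx j).ne'

theorem psi_apply (hV : Fintype.card V = N + k + 1) (o : FaceOrdering V) (F : VertexFlag V N)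
    (x : ↥(openSimplex V)) (X : Fin k → tangentT V) :
    psi hV o F x X = ((N + k).factorial : ℝ) *
      ratioIntegral (fun j => (F.block j).card - 1)
        (fun j j' => F.rho x j / (F.rho x j + F.rho x j')) *
        (F.frameBasis hV o).det (fun b => F.dTheta x (X b)) := by
  rw [psi, psiRadial_eq hV o F (rho_pos F x.2.1) (sum_block_theta F x.2.1)]
  rfl

/-! ### The limits of the pullback of a blow-up Whitney form -/

/-- The coefficient of `ρ_m` in the `j`-th radial coordinate for the flag `F` of the point with
quasi-cylindrical coordinates `(ρ, θ)` for the flag `F'`. -/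
def weight (F' F : VertexFlag V N) (θ : V → ℝ) (j m : Fin (N + 1)) : ℝ :=
  ∑ i ∈ F.block j, if F'.idx i = m then θ i else 0

/-- The smallest number `m` for which the `m`-th set of `F'` meets the `j`-th set of `F`. -/
def leadIdx (F' F : VertexFlag V N) (j : Fin (N + 1)) : Fin (N + 1) :=
  (F.block j).inf' (Finset.card_pos.1 (F.card_block_pos j)) F'.idx

theorem leadIdx_le (F' F : VertexFlag V N) (i : V) : leadIdx F' F (F.idx i) ≤ F'.idx i :=
  Finset.inf'_le _ (by simp [VertexFlag.block])

theorem exists_idx_eq_leadIdx (F' F : VertexFlag V N) (j : Fin (N + 1)) :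
    ∃ i, F.idx i = j ∧ F'.idx i = leadIdx F' F j := by
  obtain ⟨i, hi, h⟩ := (F.block j).exists_mem_eq_inf'
    (Finset.card_pos.1 (F.card_block_pos j)) F'.idx
  exact ⟨i, (Finset.mem_filter.1 hi).2, h.symm⟩

theorem leadIdx_self (F : VertexFlag V N) (j : Fin (N + 1)) : leadIdx F F j = j := by
  obtain ⟨i, h1, h2⟩ := exists_idx_eq_leadIdx F F j
  rw [← h2, h1]

theorem weight_nonneg (F' F : VertexFlag V N) {θ : V → ℝ} (hθ : ∀ i, 0 < θ i)
    (j m : Fin (N + 1)) : 0 ≤ weight F' F θ j m :=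
  Finset.sum_nonneg fun i _ => by split_ifs <;> [exact (hθ i).le; exact le_rfl]

theorem weight_leadIdx_pos (F' F : VertexFlag V N) {θ : V → ℝ} (hθ : ∀ i, 0 < θ i)
    (j : Fin (N + 1)) : 0 < weight F' F θ j (leadIdx F' F j) := by
  obtain ⟨i, h1, h2⟩ := exists_idx_eq_leadIdx F' F j
  refine Finset.sum_pos' (fun i _ => by split_ifs <;> [exact (hθ i).le; exact le_rfl])
    ⟨i, by simp [VertexFlag.block, h1], ?_⟩
  rw [if_pos h2]
  exact hθ i

theorem weight_eq_zero (F' F : VertexFlag V N) (θ : V → ℝ) {j m : Fin (N + 1)}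
    (h : m < leadIdx F' F j) : weight F' F θ j m = 0 := by
  refine Finset.sum_eq_zero fun i hi => if_neg fun h' => ?_
  have := leadIdx_le F' F i
  rw [(Finset.mem_filter.1 hi).2, h'] at this
  exact absurd h this.not_gt

theorem weight_self (F : VertexFlag V N) {θ : V → ℝ} (hθ : ∀ j, ∑ i ∈ F.block j, θ i = 1)
    (j m : Fin (N + 1)) : weight F F θ j m = if j = m then 1 else 0 := by
  have h : ∀ i ∈ F.block j, (if F.idx i = m then θ i else 0) = if j = m then θ i else 0 := by
    intro i hi
    rw [(Finset.mem_filter.1 hi).2]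
  rw [weight, Finset.sum_congr rfl h]
  split_ifs
  · exact hθ j
  · simp

theorem rho_Phi (F' F : VertexFlag V N) (ρ : Fin (N + 1) → ℝ) (θ : V → ℝ) (j : Fin (N + 1)) :
    F.rho (F'.Phi ρ θ) j = ∑ m, ρ m * weight F' F θ j m := by
  simp only [VertexFlag.rho, VertexFlag.Phi, weight, Finset.mul_sum]
  rw [Finset.sum_comm]
  simp

/-- The iterated limit of the coordinate `θ_i` for the flag `F` of the point with quasi-cylindrical
coordinates `(ρ, θ)` for the flag `F'`. -/
def limTheta (F' F : VertexFlag V N) (θ : V → ℝ) (i : V) : ℝ :=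
  (if F'.idx i = leadIdx F' F (F.idx i) then θ i else 0) /
    weight F' F θ (F.idx i) (leadIdx F' F (F.idx i))

/-- The iterated limit of the ratio `σ_j / (σ_j + σ_{j'})` of the radial coordinates `σ` for the
flag `F` of the point with quasi-cylindrical coordinates `(ρ, θ)` for the flag `F'`. -/
def limRatio (F' F : VertexFlag V N) (θ : V → ℝ) (j j' : Fin (N + 1)) : ℝ :=
  weight F' F θ j (min (leadIdx F' F j) (leadIdx F' F j')) /
    (weight F' F θ j (min (leadIdx F' F j) (leadIdx F' F j')) +
      weight F' F θ j' (min (leadIdx F' F j) (leadIdx F' F j')))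

theorem hasIterLim_theta (F' F : VertexFlag V N) {θ : V → ℝ} (hθ : ∀ i, 0 < θ i) :
    HasIterLim (fun ρ : ↥(openSimplex (Fin (N + 1))) => F.theta (F'.Phi ρ θ))
      (limTheta F' F θ) := by
  refine HasIterLim.pi fun i => ?_
  have h := hasIterLim_ratio (A := fun m => if F'.idx i = m then θ i else 0)
    (weight_nonneg F' F hθ (F.idx i)) (weight_leadIdx_pos F' F hθ (F.idx i))
    (fun m hm => if_neg fun (h : F'.idx i = m) => (leadIdx_le F' F i).not_gt (h ▸ hm))
    (fun m hm => weight_eq_zero F' F θ hm)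
  simpa [VertexFlag.theta, rho_Phi, VertexFlag.Phi, limTheta] using h

theorem hasIterLim_ratio_rho (F' F : VertexFlag V N) {θ : V → ℝ} (hθ : ∀ i, 0 < θ i) :
    HasIterLim (fun (ρ : ↥(openSimplex (Fin (N + 1)))) j j' => F.rho (F'.Phi ρ θ) j /
      (F.rho (F'.Phi ρ θ) j + F.rho (F'.Phi ρ θ) j')) (limRatio F' F θ) := by
  refine HasIterLim.pi fun j => HasIterLim.pi fun j' => ?_
  have h := hasIterLim_ratio (A := weight F' F θ j)
    (C := fun m => weight F' F θ j m + weight F' F θ j' m)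
    (m₀ := min (leadIdx F' F j) (leadIdx F' F j'))
    (fun m => add_nonneg (weight_nonneg F' F hθ j m) (weight_nonneg F' F hθ j' m)) ?_
    (fun m hm => weight_eq_zero F' F θ (lt_min_iff.1 hm).1)
    (fun m hm => by rw [weight_eq_zero F' F θ (lt_min_iff.1 hm).1,
      weight_eq_zero F' F θ (lt_min_iff.1 hm).2, add_zero])
  · simpa [rho_Phi, mul_add, Finset.sum_add_distrib, limRatio] using h
  · rcases min_choice (leadIdx F' F j) (leadIdx F' F j') with h | h <;> rw [h]
    · exact add_pos_of_pos_of_nonneg (weight_leadIdx_pos F' F hθ j) (weight_nonneg F' F hθ j' _)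
    · exact add_pos_of_nonneg_of_pos (weight_nonneg F' F hθ j _) (weight_leadIdx_pos F' F hθ j')

/-- The derivative of the angular coordinates `ξ_i = x_i / ∑_{l ∈ V_j} x_l` at `x` in the direction
of the vector with components `x_i z_i`, written in terms of `ξ` and the relative velocity `z`. -/
def thetaVelocity (F : VertexFlag V N) (ξ z : V → ℝ) (i : V) : ℝ :=
  ξ i * (z i - ∑ l ∈ F.block (F.idx i), ξ l * z l)

theorem sum_block_thetaVelocity (F : VertexFlag V N) {ξ : V → ℝ} (z : V → ℝ) {j : Fin (N + 1)}
    (hξ : ∑ i ∈ F.block j, ξ i = 1) : ∑ i ∈ F.block j, thetaVelocity F ξ z i = 0 := by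
  have h : ∀ i ∈ F.block j, thetaVelocity F ξ z i =
      ξ i * z i - ξ i * ∑ l ∈ F.block j, ξ l * z l := by
    intro i hi
    rw [thetaVelocity, (Finset.mem_filter.1 hi).2, mul_sub]
  rw [Finset.sum_congr rfl h, Finset.sum_sub_distrib, ← Finset.sum_mul, hξ, one_mul, sub_self]

theorem dTheta_dPhiAngular (F' F : VertexFlag V N) {ρ : Fin (N + 1) → ℝ} {θ : V → ℝ}
    (hθ : ∀ i, 0 < θ i) (Y : F'.tangentTheta) (i : V) :
    (F.dTheta (F'.Phi ρ θ) (F'.dPhiAngular ρ Y) : V → ℝ) i =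
      thetaVelocity F (F.theta (F'.Phi ρ θ)) (fun l => (Y : V → ℝ) l / θ l) i := by
  have hl : ∀ l, F'.Phi ρ θ l * ((Y : V → ℝ) l / θ l) = ρ (F'.idx l) * (Y : V → ℝ) l := by
    intro l
    have := (hθ l).ne'
    rw [VertexFlag.Phi]
    field_simp
  have h : ∑ l ∈ F.block (F.idx i), F.theta (F'.Phi ρ θ) l * ((Y : V → ℝ) l / θ l) =
      F.rho (F'.dPhiAngular ρ Y : V → ℝ) (F.idx i) / F.rho (F'.Phi ρ θ) (F.idx i) := by
    rw [VertexFlag.rho, Finset.sum_div]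
    refine Finset.sum_congr rfl fun l hl' => ?_
    rw [VertexFlag.theta, (Finset.mem_filter.1 hl').2, div_mul_eq_mul_div, hl]
    rfl
  rw [thetaVelocity, h, mul_sub, VertexFlag.theta, div_mul_eq_mul_div, hl, div_mul_div_comm,
    ← sq]
  rfl

/-- The pullback of a blow-up Whitney form depends continuously on angular coordinates and on
ratios of radial coordinates, so that its iterated limit exists. -/
theorem hasIterLim_pullbackTheta_psi (hV : Fintype.card V = N + k + 1) (o : FaceOrdering V)
    (F' F : VertexFlag V N) (θ : ↥F'.openTheta) (Y : Fin k → F'.tangentTheta) :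
    HasIterLim (fun ρ => pullbackTheta F' (psi hV o F) ρ θ Y)
      (((N + k).factorial : ℝ) * ratioIntegral (fun j => (F.block j).card - 1) (limRatio F' F θ) *
        Matrix.det (Matrix.of fun a b => thetaVelocity F (limTheta F' F θ)
          (fun l => (Y b : V → ℝ) l / (θ : V → ℝ) l) (F.otherVertex o (F.frameIdx hV a)))) := by
  let f : (V → ℝ) × (Fin (N + 1) → Fin (N + 1) → ℝ) → ℝ := fun q =>
    ((N + k).factorial : ℝ) * ratioIntegral (fun j => (F.block j).card - 1) q.2 *
      Matrix.det (Matrix.of fun a b => thetaVelocity F q.1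
        (fun l => (Y b : V → ℝ) l / (θ : V → ℝ) l) (F.otherVertex o (F.frameIdx hV a)))
  have hf : Continuous f := by
    refine (continuous_const.mul ((continuous_ratioIntegral _).comp continuous_snd)).mul
      (Continuous.matrix_det ?_)
    refine continuous_pi fun a => continuous_pi fun b => ?_
    simp only [Matrix.of_apply, thetaVelocity]
    fun_prop
  have h := ((hasIterLim_theta F' F θ.2.1).prodMk (hasIterLim_ratio_rho F' F θ.2.1)).comp hf
  convert h using 2 with ρ
  rw [pullbackTheta, AlternatingMap.compLinearMap_apply, psi_apply, VertexFlag.frameBasis_det]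
  simp only [f, dTheta_dPhiAngular F' F θ.2.1]

theorem sum_block_limTheta (F' F : VertexFlag V N) {θ : V → ℝ} (hθ : ∀ i, 0 < θ i)
    (j : Fin (N + 1)) : ∑ i ∈ F.block j, limTheta F' F θ i = 1 := by
  have h : ∀ i ∈ F.block j, limTheta F' F θ i =
      (if F'.idx i = leadIdx F' F j then θ i else 0) / weight F' F θ j (leadIdx F' F j) := by
    intro i hi
    rw [limTheta, (Finset.mem_filter.1 hi).2]
  rw [Finset.sum_congr rfl h, ← Finset.sum_div]
  exact div_self (weight_leadIdx_pos F' F hθ j).ne'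

theorem factorial_mul_dirichlet (hV : Fintype.card V = N + k + 1) (F : VertexFlag V N) :
    ((N + k).factorial : ℝ) * ((∏ j, (((F.block j).card - 1).factorial : ℝ)) /
      (∑ j, ((F.block j).card - 1) + N).factorial) =
        ∏ j, (((F.block j).card - 1).factorial : ℝ) := by
  rw [← F.sum_card_sub_one hV, add_comm k N]
  have : ((N + k).factorial : ℝ) ≠ 0 := by positivity
  field_simp

theorem hasIterLim_pullbackTheta_psi_self (hV : Fintype.card V = N + k + 1) (o : FaceOrdering V)
    (F : VertexFlag V N) (θ : ↥F.openTheta) (Y : Fin k → F.tangentTheta) :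
    HasIterLim (fun ρ => pullbackTheta F (psi hV o F) ρ θ Y)
      ((∏ j, (((F.block j).card - 1).factorial : ℝ)) * (F.frameBasis hV o).det Y) := by
  convert hasIterLim_pullbackTheta_psi hV o F F θ Y using 1
  rw [ratioIntegral_of_eq_one, factorial_mul_dirichlet hV, VertexFlag.frameBasis_det]
  · -- The limits of the angular coordinates are the `θ_i` themselves, and the correction term
    -- of `thetaVelocity` vanishes because `Y b` is tangent to `Θ`.
    congr 3
    ext a b
    have hlim : ∀ i, limTheta F F θ i = (θ : V → ℝ) i := by
      intro i
      simp [limTheta, leadIdx_self, weight_self F θ.2.2]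
    have hmul : ∀ l, (θ : V → ℝ) l * ((Y b : V → ℝ) l / (θ : V → ℝ) l) = (Y b : V → ℝ) l :=
      fun l => mul_div_cancel₀ _ (θ.2.1 l).ne'
    simp only [thetaVelocity, hlim, mul_sub, hmul]
    rw [(Y b).2, mul_zero, sub_zero]
  · intro j j' hj
    simp [limRatio, leadIdx_self, weight_self F θ.2.2, min_eq_left hj.le, hj.ne']

theorem flag_eq_of_monotone {V : Type*} {N : ℕ} (F' F : VertexFlag V N)
    {f : Fin (N + 1) → Fin (N + 1)} (hf : Monotone f) (h : ∀ i, F'.idx i = f (F.idx i)) :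
    F' = F := by
  have hsurj : Function.Surjective f := by
    intro m
    obtain ⟨i, hi⟩ := F'.surj m
    exact ⟨F.idx i, by rw [← h, hi]⟩
  have hstrict : StrictMono f :=
    hf.strictMono_of_injective (Finite.injective_iff_surjective.2 hsurj)
  have hid : f = id := by
    have := Subsingleton.elim (hstrict.orderIsoOfSurjective f hsurj) (OrderIso.refl _)
    funext j
    exact congrArg (fun e : Fin (N + 1) ≃o Fin (N + 1) => e j) this
  ext i
  rw [h i, hid]
  rfl

/-- For different flags the iterated limit vanishes: either a set of `F` is not contained in a set
of `F'`, and then the limits of the tangent vectors are linearly dependent; or the sets of `F`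
appear in `F'` in a wrong order, and then `R_ρ` shrinks to a null set. -/
theorem hasIterLim_pullbackTheta_psi_of_ne (hV : Fintype.card V = N + k + 1) (o : FaceOrdering V)
    {F' F : VertexFlag V N} (hF : F' ≠ F) (θ : ↥F'.openTheta) (Y : Fin k → F'.tangentTheta) :
    HasIterLim (fun ρ => pullbackTheta F' (psi hV o F) ρ θ Y) 0 := by
  convert hasIterLim_pullbackTheta_psi hV o F' F θ Y using 1
  symm
  by_cases h : ∀ i, F'.idx i = leadIdx F' F (F.idx i)
  · have hmono : ¬ Monotone (leadIdx F' F) := fun hm => hF (flag_eq_of_monotone F' F hm h)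
    obtain ⟨j, j', hj, hlt⟩ : ∃ j j', j ≤ j' ∧ leadIdx F' F j' < leadIdx F' F j := by
      simpa [Monotone] using hmono
    have hjj : j < j' := hj.lt_of_ne (by rintro rfl; exact hlt.false)
    rw [ratioIntegral_of_eq_zero _ hjj, mul_zero, zero_mul]
    rw [limRatio, min_eq_right hlt.le, weight_eq_zero F' F θ hlt, zero_div]
  · push Not at h
    obtain ⟨i, hi⟩ := h
    obtain ⟨i', h1, h2⟩ := exists_idx_eq_leadIdx F' F (F.idx i)
    let v : Fin k → F.tangentTheta := fun b => ⟨thetaVelocity F (limTheta F' F θ)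
      (fun l => (Y b : V → ℝ) l / (θ : V → ℝ) l), fun j =>
        sum_block_thetaVelocity F _ (sum_block_limTheta F' F θ.2.1 j)⟩
    -- The limit vectors have a zero component at `i`, which shares its set `V_j` with `i'`.
    have hdet := F.frameBasis_det_eq_zero hV o v (i := i) (i' := i')
      (by rintro rfl; exact hi h2) h1.symm
      (fun b => by simp [v, thetaVelocity, limTheta, hi])
    rw [VertexFlag.frameBasis_det] at hdet
    exact mul_eq_zero_of_right _ hdet

/-! ### Degrees of freedom -/

theorem thetaChart_otherVertex (F : VertexFlag V N) (o : FaceOrdering V) (s : F.ThetaIdx → ℝ)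
    (b : F.ThetaIdx) : F.thetaChart o s (F.otherVertex o b) = s b := by
  classical
  simp [VertexFlag.thetaChart, Finset.sum_apply, VertexFlag.frameVector_otherVertex,
    F.otherVertex_ne_baseVertex]

theorem thetaChart_baseVertex (F : VertexFlag V N) (o : FaceOrdering V) (s : F.ThetaIdx → ℝ)
    (j : Fin (N + 1)) : F.thetaChart o s (F.baseVertex o j) = 1 - ∑ l, s ⟨j, l⟩ := by
  classical
  have h : ∑ a, s a * (if a.1 = j then -1 else 0) = -∑ l, s ⟨j, l⟩ := by
    rw [Fintype.sum_sigma, Finset.sum_eq_single j]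
    · simp
    · intro j' _ hj; simp [hj]
    · simp
  simp [VertexFlag.thetaChart, Finset.sum_apply, VertexFlag.frameVector_baseVertex,
    Pi.single_apply, (F.baseVertex_injective o).eq_iff, sub_eq_add_neg, -mul_ite, h]

theorem thetaChart_mem_openTheta (F : VertexFlag V N) (o : FaceOrdering V) (s : F.ThetaIdx → ℝ) :
    F.thetaChart o s ∈ F.openTheta ↔ ∀ j, (∀ l, 0 < s ⟨j, l⟩) ∧ ∑ l, s ⟨j, l⟩ < 1 := by
  have hsum : ∀ j, ∑ i ∈ F.block j, F.thetaChart o s i = 1 := by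
    intro j
    rw [F.sum_block_eq o, thetaChart_baseVertex]
    simp [thetaChart_otherVertex]
  have hpos : (∀ i, 0 < F.thetaChart o s i) ↔
      (∀ j, 0 < 1 - ∑ l, s ⟨j, l⟩) ∧ ∀ a, 0 < s a := by
    rw [← (F.vertexEquiv o).forall_congr_right, Sum.forall]
    simp only [VertexFlag.vertexEquiv_inl, VertexFlag.vertexEquiv_inr, thetaChart_baseVertex,
      thetaChart_otherVertex]
  constructor
  · intro h j
    have := hpos.1 h.1
    exact ⟨fun l => this.2 _, sub_pos.1 (this.1 j)⟩
  · intro h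
    exact ⟨hpos.2 ⟨fun j => sub_pos.2 (h j).2, fun a => (h a.1).1 a.2⟩, hsum⟩

theorem volume_thetaChart (F : VertexFlag V N) (o : FaceOrdering V) :
    volume {s | F.thetaChart o s ∈ F.openTheta} =
      ENNReal.ofReal (∏ j, 1 / (((F.block j).card - 1).factorial : ℝ)) := by
  rw [← volume_prod_cornerSimplex]
  congr 1
  ext s
  exact thetaChart_mem_openTheta F o s

theorem measurableSet_thetaChart (F : VertexFlag V N) (o : FaceOrdering V) :
    MeasurableSet {s | F.thetaChart o s ∈ F.openTheta} := by
  have : {s | F.thetaChart o s ∈ F.openTheta} =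
      {s : F.ThetaIdx → ℝ | ∀ j, (∀ l, 0 < s ⟨j, l⟩) ∧ ∑ l, s ⟨j, l⟩ < 1} :=
    Set.ext (thetaChart_mem_openTheta F o)
  rw [this]
  refine IsOpen.measurableSet ?_
  simp only [Set.ofPred_forall, Set.ofPred_and]
  refine isOpen_iInter_of_finite fun j => IsOpen.inter ?_ ?_
  · exact isOpen_iInter_of_finite fun l => isOpen_lt continuous_const (by fun_prop)
  · exact isOpen_lt (by fun_prop) continuous_const

theorem thetaCoeff_const_smul_det (hV : Fintype.card V = N + k + 1) (o : FaceOrdering V)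
    (F : VertexFlag V N) (c : ℝ) :
    thetaCoeff hV o F (fun _ => c • (F.frameBasis hV o).det) =
      {s | F.thetaChart o s ∈ F.openTheta}.indicator fun _ => c := by
  classical
  ext s
  by_cases h : F.thetaChart o s ∈ F.openTheta
  · rw [thetaCoeff, dif_pos h, Set.indicator_of_mem (by exact h), AlternatingMap.smul_apply,
      ← F.coe_frameBasis, Module.Basis.det_self, smul_eq_mul, mul_one]
  · rw [thetaCoeff, dif_neg h, Set.indicator_of_notMem (by exact h)]

/-- A multiple `c` of the coordinate determinant has integral `c` times the volume of the chart
domain of `Θ`, a product of simplices. -/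
theorem hasDof_of_hasIterLim (hV : Fintype.card V = N + k + 1) (o : FaceOrdering V)
    (F : VertexFlag V N) (ψ : KForm V k) (c : ℝ)
    (h : ∀ (θ : ↥F.openTheta) Y, HasIterLim (fun ρ => pullbackTheta F ψ ρ θ Y)
      (c * (F.frameBasis hV o).det Y)) :
    HasDof hV o F ψ (c * ∏ j, 1 / (((F.block j).card - 1).factorial : ℝ)) := by
  refine ⟨fun _ => c • (F.frameBasis hV o).det, h, ?_, ?_⟩
  · rw [thetaCoeff_const_smul_det, integrable_indicator_iff (measurableSet_thetaChart F o)]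
    refine integrableOn_const ?_ (by simp)
    rw [volume_thetaChart]
    exact ENNReal.ofReal_ne_top
  · rw [thetaCoeff_const_smul_det, integral_indicator_const _ (measurableSet_thetaChart F o),
      measureReal_def, volume_thetaChart, ENNReal.toReal_ofReal, smul_eq_mul, mul_comm]
    exact Finset.prod_nonneg fun j _ => by positivity

theorem hasDof_psi (hV : Fintype.card V = N + k + 1) (o : FaceOrdering V)
    (F' F : VertexFlag V N) :
    HasDof hV o F' (psi hV o F) (if F' = F then 1 else 0) := by
  split_ifs with h
  · subst h
    convert hasDof_of_hasIterLim hV o F' _ _ (hasIterLim_pullbackTheta_psi_self hV o F') using 1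
    rw [← Finset.prod_mul_distrib]
    refine (Finset.prod_eq_one fun j _ => mul_one_div_cancel ?_).symm
    positivity
  · have h0 := hasDof_of_hasIterLim hV o F' (psi hV o F) 0 fun θ Y => by
      rw [zero_mul]
      exact hasIterLim_pullbackTheta_psi_of_ne hV o h θ Y
    rwa [zero_mul] at h0

theorem HasDof.unique {hV : Fintype.card V = N + k + 1} {o : FaceOrdering V}
    {F : VertexFlag V N} {ψ : KForm V k} {c c' : ℝ} (h : HasDof hV o F ψ c)
    (h' : HasDof hV o F ψ c') : c = c' := by
  obtain ⟨η, h1, -, rfl⟩ := h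
  obtain ⟨η', h1', -, rfl⟩ := h'
  have : η = η' := by
    ext θ Y
    exact HasIterLim.unique (hasIteratedLimit_iff.1 (h1 θ Y)) (hasIteratedLimit_iff.1 (h1' θ Y))
  rw [this]

theorem HasDof.add {hV : Fintype.card V = N + k + 1} {o : FaceOrdering V}
    {F : VertexFlag V N} {ψ ψ' : KForm V k} {c c' : ℝ} (h : HasDof hV o F ψ c)
    (h' : HasDof hV o F ψ' c') : HasDof hV o F (ψ + ψ') (c + c') := by
  obtain ⟨η, h1, h2, rfl⟩ := h
  obtain ⟨η', h1', h2', rfl⟩ := h'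
  have hco : thetaCoeff hV o F (η + η') = fun s => thetaCoeff hV o F η s +
      thetaCoeff hV o F η' s := by
    ext s
    simp only [thetaCoeff]
    split_ifs <;> simp
  refine ⟨η + η', fun θ Y => ?_, ?_, ?_⟩
  · exact (HasIterLim.prodMk (hasIteratedLimit_iff.1 (h1 θ Y))
      (hasIteratedLimit_iff.1 (h1' θ Y))).comp continuous_add
  · rw [hco]
    exact h2.add h2'
  · rw [hco, integral_add h2 h2']

theorem HasDof.smul {hV : Fintype.card V = N + k + 1} {o : FaceOrdering V}
    {F : VertexFlag V N} {ψ : KForm V k} {c : ℝ} (a : ℝ) (h : HasDof hV o F ψ c) :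
    HasDof hV o F (a • ψ) (a * c) := by
  obtain ⟨η, h1, h2, rfl⟩ := h
  have hco : thetaCoeff hV o F (a • η) = fun s => a * thetaCoeff hV o F η s := by
    ext s
    simp only [thetaCoeff]
    split_ifs <;> simp
  refine ⟨a • η, fun θ Y => ?_, ?_, ?_⟩
  · exact (hasIteratedLimit_iff.1 (h1 θ Y)).comp (continuous_const_mul a)
  · rw [hco]
    exact h2.const_mul a
  · rw [hco, integral_const_mul]

instance (V : Type*) [Fintype V] (N : ℕ) : Finite (VertexFlag V N) :=
  Finite.of_injective VertexFlag.idx fun _ _ h => VertexFlag.ext h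

theorem hasDof_sum {hV : Fintype.card V = N + k + 1} {o : FaceOrdering V} {F : VertexFlag V N}
    {ι : Type*} (s : Finset ι) {ψ : ι → KForm V k} {c : ι → ℝ}
    (h : ∀ i ∈ s, HasDof hV o F (ψ i) (c i)) : HasDof hV o F (∑ i ∈ s, ψ i) (∑ i ∈ s, c i) := by
  classical
  induction s using Finset.induction_on with
  | empty =>
    -- The zero form is a multiple of some `ψ_F`.
    have h0 := (hasDof_psi hV o F F).smul 0
    simpa using h0
  | insert i s hi ih =>
    rw [Finset.sum_insert hi, Finset.sum_insert hi]
    exact (h i (Finset.mem_insert_self i s)).add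
      (ih fun i' hi' => h i' (Finset.mem_insert_of_mem hi'))

theorem hasDof_sum_smul_psi [Fintype (VertexFlag V N)] (hV : Fintype.card V = N + k + 1)
    (o : FaceOrdering V) (F : VertexFlag V N) (a : VertexFlag V N → ℝ) :
    HasDof hV o F (∑ F₁, a F₁ • psi hV o F₁) (a F) := by
  have := hasDof_sum Finset.univ fun F₁ _ => (hasDof_psi hV o F F₁).smul (a F₁)
  simpa using this

theorem linearIndependent_psi (hV : Fintype.card V = N + k + 1) (o : FaceOrdering V) :
    LinearIndependent ℝ fun F : VertexFlag V N => psi hV o F := by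
  cases nonempty_fintype (VertexFlag V N)
  rw [Fintype.linearIndependent_iff]
  intro a ha F
  have h0 := hasDof_sum_smul_psi hV o F 0
  have h1 := hasDof_sum_smul_psi hV o F a
  rw [ha] at h1
  simp only [Pi.zero_apply, zero_smul, Finset.sum_const_zero] at h0
  exact h1.unique h0

end

end BlowUpWhitney

end

theorem mainTheorem2 {V : Type*} [Fintype V] (N k : ℕ) (hV : Fintype.card V = N + k + 1)
    (o : FaceOrdering V) :
    (∀ (F' F : VertexFlag V N) (c : ℝ),
      HasDof hV o F' (psi hV o F) c ↔ c = if F' = F then 1 else 0) ∧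
    ∃ (b : Module.Basis (VertexFlag V N) ℝ (blowUpWhitneySpace (N := N) (k := k) hV o))
      (B : Module.Basis (VertexFlag V N) ℝ
        (Module.Dual ℝ (blowUpWhitneySpace (N := N) (k := k) hV o))),
      (∀ F, (b F : KForm V k) = psi hV o F) ∧
      (∀ (F : VertexFlag V N) (ψ : blowUpWhitneySpace (N := N) (k := k) hV o) (c : ℝ),
        HasDof hV o F (ψ : KForm V k) c ↔ c = B F ψ) ∧
      ∀ F' F : VertexFlag V N, B F' (b F) = if F' = F then 1 else 0 := by
  cases nonempty_fintype (VertexFlag V N)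
  refine ⟨fun F' F c => ⟨fun h => h.unique (hasDof_psi hV o F' F),
    fun h => h ▸ hasDof_psi hV o F' F⟩, ?_⟩
  let b : Module.Basis (VertexFlag V N) ℝ (blowUpWhitneySpace (N := N) (k := k) hV o) :=
    Module.Basis.span (linearIndependent_psi hV o)
  have hb : ∀ F, (b F : KForm V k) = psi hV o F := fun F =>
    congrArg Subtype.val (Module.Basis.span_apply (linearIndependent_psi hV o) F)
  have hB : ∀ (F : VertexFlag V N) (ψ : blowUpWhitneySpace (N := N) (k := k) hV o),
      HasDof hV o F (ψ : KForm V k) (b.dualBasis F ψ) := by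
    intro F ψ
    have h := hasDof_sum_smul_psi hV o F (b.repr ψ)
    have hψ : (ψ : KForm V k) = ∑ F₁, b.repr ψ F₁ • psi hV o F₁ := by
      conv_lhs => rw [← b.sum_repr ψ]
      simp only [Submodule.coe_sum, Submodule.coe_smul, hb]
    rw [← hψ] at h
    simpa [Module.Basis.dualBasis_apply] using h
  refine ⟨b, b.dualBasis, hb, fun F ψ c => ⟨fun h => h.unique (hB F ψ), fun h => h ▸ hB F ψ⟩,
    fun F' F => ?_⟩
  rw [Module.Basis.dualBasis_apply_self]
  simp only [eq_comm]
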